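/- Let $T$ be a complete first-order theory in a vocabulary $\tau$, let $|T|=|\tau|+\aleph_0$ be the number of first-order formulas of the vocabulary, and let $\mathfrak C$ be a monster model of $T$ (a $\bar\kappa$-saturated model of $T$ for some $\bar\kappa>|T|$). Here $T$ is *dependent* if there are no formula $\varphi(\bar x,\bar y)$, model $M\models T$ and tuples $\bar a_u$ ($u\subseteq\omega$), $\bar b_n$ ($n<\omega$) from $M$ with $M\models\varphi[\bar a_u,\bar b_n]\Leftrightarrow n\in u$. A set $\mathbf I\subseteq{}^{\alpha}\mathfrak C$ of tuples of length $\alpha$ is an *indiscernible set* if for every $n$ and all sequences $\bar a_0,\dots,\bar a_{n-1}$ and $\bar b_0,\dots,\bar b_{n-1}$ of pairwise distinct members of $\mathbf I$, the concatenations $\bar a_0{}^\frown\cdots{}^\frown\bar a_{n-1}$ and $\bar b_0{}^\frown\cdots{}^\frown\bar b_{n-1}$ have the same type over $\emptyset$ in $\mathfrak C$. It is a *stable indiscernible set* if it is an infinite indiscernible set and for every formula $\varphi(\bar x,\bar y)$ and every $\bar b$ from $\mathfrak C$, one of $\{\bar a\in\mathbf I:\mathfrak C\models\varphi[\bar a,\bar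 b]\}$ and $\{\bar a\in\mathbf I:\mathfrak C\models\neg\varphi[\bar a,\bar b]\}$ is finite. A model $M$ is *$\kappa$-saturated* if every complete $1$-type over a subset of $M$ of cardinality $<\kappa$ is realized in $M$, and *exactly $\kappa$-saturated* if it is $\kappa$-saturated but not $\kappa^+$-saturated. Then: (0) If $T$ is dependent, then for every $\alpha$, a set $\mathbf I\subseteq{}^{\alpha}\mathfrak C$ is a stable indiscernible set if and only if it is an infinite indiscernible set. (1) If $T$ is dependent and there is an infinite indiscernible set $\mathbf I\subseteq\mathfrak C$ (a set of elements), then for every cardinal $\kappa$ with $2^{\kappa}=\kappa^{+}$ and $\kappa>|T|$, $T$ has an exactly $\kappa$-saturated model. (2) If $T$ is not necessarily dependent and there is a stable indiscernible set $\mathbf I\subseteq\mathfrak C$ (a set of elements), then for every cardinal $\kappa$ with $2^{\kappa}=\kappa^{+}$ and $\kappa>|T|$, $T$ has an exactly $\kappa$-saturated model. -/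

import Mathlib

open scoped FirstOrder Cardinal

universe u v w w' z

namespace ExactSat

/-- The cardinality `|T|` of a complete first order theory in the language `L`, i.e. the number
of first order formulas of its vocabulary: `|L| + ℵ₀`. -/
noncomputable def theoryCard (L : FirstOrder.Language.{u, v}) : Cardinal.{max u v} :=
  max L.card ℵ₀

/-- `T` is independent (has the independence property): there are a formula `φ(x̄, ȳ)`, a model `M`
of `T` and tuples `a_s` (`s ⊆ ω`), `b_k` (`k < ω`) of `M` with `M ⊨ φ[a_s, b_k] ↔ k ∈ s`. -/
def IsIndependent {L : FirstOrder.Language.{u, v}} (T : L.Theory) : Prop :=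
  ∃ (M : FirstOrder.Language.Theory.ModelType.{u, v, max u v} T) (m n : ℕ) (φ : L.Formula (Fin m ⊕ Fin n))
    (a : Set ℕ → Fin m → M) (b : ℕ → Fin n → M),
    ∀ (s : Set ℕ) (k : ℕ), φ.Realize (Sum.elim (a s) (b k)) ↔ k ∈ s

/-- `T` is dependent: it does not have the independence property. -/
def IsDependent {L : FirstOrder.Language.{u, v}} (T : L.Theory) : Prop :=
  ¬ IsIndependent T

/-- The complete type of the tuple `c` of `N` over the parameters `g : A → N`: the set of all
formulas `φ(x̄)` with parameters named by `A` that `c` satisfies in `N`. -/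
def tp (L : FirstOrder.Language.{u, v}) {N : Type w} [L.Structure N] {A : Type w'} (g : A → N)
    {ι : Type z} (c : ι → N) : Set (L.Formula (A ⊕ ι)) :=
  {φ | φ.Realize (Sum.elim g c)}

/-- `M` is `κ`-saturated: for every `A ⊆ M` with `|A| < κ`, every complete 1-type over `A`
(the type `tp(c, A, N)` of an element `c` of an elementary extension `f : M ↪ₑ N`) is realized
by an element `d` of `M`. -/
def IsSaturated (L : FirstOrder.Language.{u, v}) (M : Type (max u v)) [L.Structure M]
    (κ : Cardinal.{max u v}) : Prop :=
  ∀ A : Set M, #A < κ →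
    ∀ (N : Type (max u v)) [L.Structure N] (f : M ↪ₑ[L] N) (c : Fin 1 → N),
      ∃ d : Fin 1 → M, tp L (fun a : A => (a : M)) d = tp L (fun a : A => f (a : M)) c

/-- `M` is exactly `κ`-saturated: it is `κ`-saturated but not `κ⁺`-saturated. -/
def IsExactlySaturated (L : FirstOrder.Language.{u, v}) (M : Type (max u v)) [L.Structure M]
    (κ : Cardinal.{max u v}) : Prop :=
  IsSaturated L M κ ∧ ¬ IsSaturated L M (Order.succ κ)

/-- A set `I` of `ι`-tuples of `M` is an indiscernible set: for every `n`, any two concatenations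
of `n` pairwise distinct members of `I` (in any order) satisfy the same formulas in `M`. -/
def IsIndiscernibleSet (L : FirstOrder.Language.{u, v}) {M : Type w} [L.Structure M] {ι : Type z}
    (I : Set (ι → M)) : Prop :=
  ∀ (n : ℕ) (a b : Fin n ↪ I) (φ : L.Formula (Fin n × ι)),
    φ.Realize (fun p => (a p.1 : ι → M) p.2) ↔ φ.Realize (fun p => (b p.1 : ι → M) p.2)

/-- A set `I` of `ι`-tuples of `M` is a stable indiscernible set, with respect to `M`: it is an
infinite indiscernible set and its average type over `M` is well defined, i.e. for every formula
`φ(x̄, b̄)` with parameters `b̄` in `M`, either `φ(I, b̄)` or `¬φ(I, b̄)` is finite. -/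
def IsStableIndiscernibleSet (L : FirstOrder.Language.{u, v}) {M : Type w} [L.Structure M] {ι : Type z}
    (I : Set (ι → M)) : Prop :=
  I.Infinite ∧ IsIndiscernibleSet L I ∧
    ∀ (n : ℕ) (φ : L.Formula (ι ⊕ Fin n)) (b : Fin n → M),
      {a ∈ I | φ.Realize (Sum.elim a b)}.Finite ∨ {a ∈ I | ¬ φ.Realize (Sum.elim a b)}.Finite

/-- `T` has an exactly `κ`-saturated model. -/
def HasExactlySaturatedModel {L : FirstOrder.Language.{u, v}} (T : L.Theory)
    (κ : Cardinal.{max u v}) : Prop :=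
  ∃ M : FirstOrder.Language.Theory.ModelType.{u, v, max u v} T, IsExactlySaturated L M κ

end ExactSat

/-! For (0): if a formula and its negation both hold infinitely often on an indiscernible set, then
every subset of a finite part of that set is cut out by some parameter
(`IsIndiscernibleSet.shatter`), and compactness yields the independence property. Hence (1) reduces
to (2).

For (2), the desired model contains an indiscernible set `J` of size κ and omits its average type
over `J`, which refutes κ⁺-saturation. Omission is guaranteed by `Good`: the relation of a finite
tuple `d` to almost all of `J` is settled by one `J`-definable set containing `d`. Applied to
equality, this puts `d` in a `J`-definable set that misses almost all of `J`
(`not_isSaturated_of_goodSet`).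

Stability and the saturation of `C` bound uniformly how a formula splits `I`
(`IsStableIndiscernibleSet.exists_bound`), and the bound passes to `J` (`SplitBound`). The heart is
`GoodSet.exists_insert`: a partial type of size < κ over a good set `A` has a realization that keeps
`A` good. By the bound, finitely many further formulas decide `R(d, x, j)` for almost all `j`. The
partial type being smaller than `J`, one finite part of it decides infinitely many `j`, and goodness
of `A` turns that part into a `J`-definable condition (`GoodSet.exists_uniform`). Meeting κ such
requirements in turn gives a partial type of size κ.

That type is realized in a set `U` of size at most κ⁺ that realizes all such types over itself,
obtained by a Henkin construction (`exists_henkin_model`). As 2^κ = κ⁺, there are only κ⁺ small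
families over `U`, and adding points κ⁺ times gives a good κ-saturated model
(`exists_saturated_goodSet`). -/

namespace ExactSat

/-! ### Transfinite unions, used to build formula sets, types and models -/

section TransfiniteUnion

variable {W X : Type w} [LinearOrder W]

/-- A transfinite increasing union: at stage `k` the set `Δ (q k) k` is added. -/
theorem exists_transfinite_union [WellFoundedLT W] (q₀ : Set X) (Δ : Set X → W → Set X) :
    ∃ q : W → Set X, ∀ i, q i = q₀ ∪ ⋃ k < i, Δ (q k) k :=
  ⟨wellFounded_lt.fix fun i f => q₀ ∪ ⋃ (k) (h : k < i), Δ (f k h) k, fun i => by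
    rw [WellFounded.fix_eq]⟩

variable {q₀ : Set X} {Δ : Set X → W → Set X} {q : W → Set X}

theorem transfinite_union_subset (hq : ∀ i, q i = q₀ ∪ ⋃ k < i, Δ (q k) k) {k i : W}
    (h : k < i) : q k ∪ Δ (q k) k ⊆ q i := by
  rintro x (hx | hx)
  · rw [hq] at hx ⊢
    rcases hx with hx | hx
    · exact Or.inl hx
    · simp only [Set.mem_iUnion] at hx
      obtain ⟨j, hj, hx⟩ := hx
      exact Or.inr (by simp only [Set.mem_iUnion]; exact ⟨j, hj.trans h, hx⟩)
  · rw [hq i]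
    exact Or.inr (by simp only [Set.mem_iUnion]; exact ⟨k, h, hx⟩)

theorem transfinite_union_mono (hq : ∀ i, q i = q₀ ∪ ⋃ k < i, Δ (q k) k) {k i : W}
    (h : k ≤ i) : q k ⊆ q i := by
  rcases h.eq_or_lt with rfl | h
  · exact subset_rfl
  · exact Set.subset_union_left.trans (transfinite_union_subset hq h)

theorem transfinite_union_subset_total (hq : ∀ i, q i = q₀ ∪ ⋃ k < i, Δ (q k) k) (i : W) :
    q i ∪ Δ (q i) i ⊆ q₀ ∪ ⋃ k, Δ (q k) k := by
  rintro x (hx | hx)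
  · rw [hq] at hx
    rcases hx with hx | hx
    · exact Or.inl hx
    · simp only [Set.mem_iUnion] at hx
      obtain ⟨j, hj, hx⟩ := hx
      exact Or.inr (Set.mem_iUnion.2 ⟨j, hx⟩)
  · exact Or.inr (Set.mem_iUnion.2 ⟨i, hx⟩)

/-- The stages increase, so the latest of finitely many stages contains the others. -/
theorem finite_subset_transfinite_union (hq : ∀ i, q i = q₀ ∪ ⋃ k < i, Δ (q k) k) (S : Set W)
    {t : Set X} (ht : t.Finite) (hts : t ⊆ q₀ ∪ ⋃ k ∈ S, Δ (q k) k) :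
    t ⊆ q₀ ∨ ∃ k ∈ S, t ⊆ q k ∪ Δ (q k) k := by
  induction t, ht using Set.Finite.induction_on with
  | empty => exact Or.inl (Set.empty_subset _)
  | @insert a t _ _ ih =>
    have hq₀ : ∀ k, q₀ ⊆ q k := fun k => by rw [hq k]; exact Set.subset_union_left
    have ha := hts (Set.mem_insert _ _)
    have ih := ih ((Set.subset_insert _ _).trans hts)
    simp only [Set.mem_union, Set.mem_iUnion, exists_prop] at ha
    simp only [Set.insert_subset_iff]
    rcases ih with ih | ⟨k, hk, ih⟩
    · rcases ha with ha | ⟨j, hj, ha⟩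
      · exact Or.inl ⟨ha, ih⟩
      · exact Or.inr ⟨j, hj, Or.inr ha, ih.trans ((hq₀ j).trans Set.subset_union_left)⟩
    · rcases ha with ha | ⟨j, hj, ha⟩
      · exact Or.inr ⟨k, hk, Or.inl (hq₀ k ha), ih⟩
      · rcases lt_trichotomy j k with h | rfl | h
        · exact Or.inr ⟨k, hk, Or.inl (transfinite_union_subset hq h (Or.inr ha)), ih⟩
        · exact Or.inr ⟨j, hj, Or.inr ha, ih⟩
        · exact Or.inr ⟨j, hj, Or.inr ha,
            ih.trans ((transfinite_union_subset hq h).trans Set.subset_union_left)⟩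

/-- Since `P` has finite character, limit stages need no separate hypothesis. -/
theorem transfinite_union_induction [WellFoundedLT W] {P : Set X → Prop}
    (hq : ∀ i, q i = q₀ ∪ ⋃ k < i, Δ (q k) k)
    (hmono : ∀ s t, s ⊆ t → P t → P s) (hfin : ∀ s, (∀ t ⊆ s, t.Finite → P t) → P s)
    (h₀ : P q₀) (hstep : ∀ i, P (q i) → P (q i ∪ Δ (q i) i)) :
    (∀ i, P (q i)) ∧ P (q₀ ∪ ⋃ k, Δ (q k) k) := by
  have key : ∀ S : Set W, (∀ k ∈ S, P (q k)) → P (q₀ ∪ ⋃ k ∈ S, Δ (q k) k) := by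
    intro S hS
    refine hfin _ fun t ht htf => ?_
    rcases finite_subset_transfinite_union hq S htf ht with h | ⟨k, hk, h⟩
    · exact hmono _ _ h h₀
    · exact hmono _ _ h (hstep k (hS k hk))
  have h1 : ∀ i, P (q i) := by
    intro i
    induction i using WellFoundedLT.induction with
    | _ i ih =>
      rw [hq i]
      exact key (Set.Iio i) ih
  refine ⟨h1, ?_⟩
  simpa using key Set.univ fun k _ => h1 k

/-- The increments being finite, stage `i` adds at most ℵ₀ · |`Iio i`| points, so `l` may be
singular. -/
theorem mk_transfinite_union_lt {l : Cardinal.{w}} (hl : ℵ₀ < l)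
    (hq : ∀ i, q i = q₀ ∪ ⋃ k < i, Δ (q k) k) (h₀ : #q₀ < l) (hW : ∀ i : W, #(Set.Iio i) < l)
    (hΔ : ∀ s i, (Δ s i).Finite) (i : W) : #(q i) < l := by
  rw [hq i]
  refine (Cardinal.mk_union_le _ _).trans_lt (Cardinal.add_lt_of_lt hl.le h₀ ?_)
  have : (⋃ k < i, Δ (q k) k) = ⋃ k : Set.Iio i, Δ (q k) k := by
    ext x; simp
  rw [this]
  refine (Cardinal.mk_iUnion_le_sum_mk).trans_lt ?_
  refine (Cardinal.sum_le_mk_mul_iSup _).trans_lt (Cardinal.mul_lt_of_lt hl.le (hW i) ?_)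
  refine lt_of_le_of_lt (ciSup_le' fun k => ?_) hl
  exact (Cardinal.mk_le_aleph0_iff.2 (hΔ _ _).countable.to_subtype)

end TransfiniteUnion

/-! ### Compactness by ultraproducts -/

section Compactness

variable {L : FirstOrder.Language.{u, v}}

/-- Finite satisfiability of a set of formulas in models of `T`. -/
def FinSat (T : L.Theory) {V : Type z} (Γ : Set (L.Formula V)) : Prop :=
  ∀ s ⊆ Γ, s.Finite → ∃ (M : FirstOrder.Language.Theory.ModelType.{u, v, max u v} T) (x : V → M),
    ∀ γ ∈ s, γ.Realize x

theorem FinSat.mono {T : L.Theory} {V : Type z} {Γ Γ' : Set (L.Formula V)} (h : Γ ⊆ Γ')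
    (hΓ : FinSat T Γ') : FinSat T Γ :=
  fun s hs => hΓ s (hs.trans h)

theorem FinSat.of_finite {T : L.Theory} {V : Type z} {Γ : Set (L.Formula V)}
    (h : ∀ s ⊆ Γ, s.Finite → FinSat T s) : FinSat T Γ :=
  fun s hs hf => h s hs hf s subset_rfl hf

open FirstOrder.Language in
/-- Compactness for sets of formulas. -/
theorem FinSat.exists_realize {T : L.Theory} {V : Type z} {Γ : Set (L.Formula V)}
    (h : FinSat T Γ) : ∃ (M : Theory.ModelType.{u, v, max u v z} T) (x : V → M),
      ∀ γ ∈ Γ, γ.Realize x := by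
  have h' : ∀ s : Finset Γ, ∃ (M : Theory.ModelType.{u, v, max u v} T) (x : V → M),
      ∀ γ ∈ s, (γ : L.Formula V).Realize x := by
    intro s
    obtain ⟨M, x, hx⟩ := h (Subtype.val '' (s : Set Γ)) (by rintro _ ⟨γ, -, rfl⟩; exact γ.2)
      (s.finite_toSet.image _)
    exact ⟨M, x, fun γ hγ => hx _ ⟨γ, hγ, rfl⟩⟩
  choose M x hx using h'
  let U : Ultrafilter (Finset Γ) := Ultrafilter.of Filter.atTop
  let N := (U : Filter (Finset Γ)).Product fun s => (M s : Type (max u v))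
  have hT : N ⊨ T := by
    refine ⟨fun φ hφ => ?_⟩
    rw [Ultraproduct.sentence_realize]
    exact Filter.Eventually.of_forall fun s => Theory.realize_sentence_of_mem T hφ
  refine ⟨Theory.ModelType.of T N, fun i => ((fun s => x s i : ∀ s, M s) : N), fun γ hγ => ?_⟩
  refine (Ultraproduct.realize_formula_cast γ fun i s => x s i).2 ?_
  refine Ultrafilter.of_le Filter.atTop ?_
  filter_upwards [Filter.eventually_ge_atTop ({⟨γ, hγ⟩} : Finset Γ)] with s hs
  exact hx s ⟨γ, hγ⟩ (hs (by simp))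

end Compactness

/-! ### Indiscernible sets in dependent theories -/

section Indiscernible

variable {L : FirstOrder.Language.{u, v}}

/-- A formula that splits an indiscernible set in two large parts shatters all its finite
subsets. -/
theorem IsIndiscernibleSet.shatter {M : Type w} [L.Structure M] {ι : Type z} {I : Set (ι → M)}
    (hI : IsIndiscernibleSet L I) {m n : ℕ} (φ : L.Formula (ι ⊕ Fin m)) (b : Fin m → M)
    (p q : Fin n ↪ I) (hp : ∀ k, φ.Realize (Sum.elim (p k : ι → M) b))
    (hq : ∀ k, ¬ φ.Realize (Sum.elim (q k : ι → M) b)) (e : Fin n ↪ I) (s : Set (Fin n)) :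
    ∃ b' : Fin m → M, ∀ k, φ.Realize (Sum.elim (e k : ι → M) b') ↔ k ∈ s := by
  classical
  let φ' : Fin n → L.Formula ((Fin n × ι) ⊕ Fin m) := fun k =>
    φ.relabel (Sum.map (fun i => (k, i)) id)
  -- Realizability of the pattern `s` is a single formula in the `n` points, so indiscernibility
  -- carries it from one list of points to another.
  let ψ : L.Formula (Fin n × ι) :=
    (FirstOrder.Language.Formula.iInf fun k => if k ∈ s then φ' k else ∼(φ' k)).iExs (Fin m)
  have hφ' : ∀ (f : Fin n ↪ I) (c : Fin m → M) (k : Fin n),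
      (φ' k).Realize (Sum.elim (fun p => (f p.1 : ι → M) p.2) c) ↔
        φ.Realize (Sum.elim (f k : ι → M) c) := by
    intro f c k
    rw [FirstOrder.Language.Formula.realize_relabel, Sum.elim_comp_map]
    rfl
  have hψ : ∀ f : Fin n ↪ I, ψ.Realize (fun p => (f p.1 : ι → M) p.2) ↔
      ∃ c : Fin m → M, ∀ k, φ.Realize (Sum.elim (f k : ι → M) c) ↔ k ∈ s := by
    intro f
    simp only [ψ, FirstOrder.Language.Formula.realize_iExs,
      FirstOrder.Language.Formula.realize_iInf]
    refine exists_congr fun c => forall_congr' fun k => ?_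
    by_cases hk : k ∈ s <;> simp [hk, hφ']
  -- On this list `b` itself realizes the pattern; `φ(·, b)` separates the two kinds of points,
  -- whence injectivity.
  let f : Fin n ↪ I := ⟨fun k => if k ∈ s then p k else q k, by
    intro k l hkl
    by_cases hk : k ∈ s <;> by_cases hl : l ∈ s <;> simp only [hk, hl, if_true, if_false] at hkl
    · exact p.injective hkl
    · exact absurd (hkl ▸ hp k) (hq l)
    · exact absurd (hkl ▸ hp l) (hq k)
    · exact q.injective hkl⟩
  rw [← hψ, hI n e f ψ, hψ]
  refine ⟨b, fun k => ?_⟩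
  by_cases hk : k ∈ s
  · have hfk : f k = p k := if_pos hk
    simp only [hfk, hp, hk]
  · have hfk : f k = q k := if_neg hk
    simp only [hfk, hq, hk]

open FirstOrder.Language in
-- The tuples of an indiscernible set may be infinite, while the independence property concerns
-- finite tuples.
theorem exists_finite_support {ι : Type w} {β : Type z} (φ : L.Formula (ι ⊕ β)) :
    ∃ (m : ℕ) (e : Fin m → ι) (ψ : L.Formula (Fin m ⊕ β)),
      ∀ (M : Type w') [L.Structure M] (a : ι → M) (b : β → M),
        ψ.Realize (Sum.elim (a ∘ e) b) ↔ φ.Realize (Sum.elim a b) := by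
  classical
  let S := φ.freeVarFinset.toLeft
  refine ⟨S.card, fun i => S.equivFin.symm i, φ.restrictFreeVar fun x => Sum.casesOn x.1
    (fun x hx => Sum.inl (S.equivFin ⟨x, by simpa [S] using hx⟩)) (fun x _ => Sum.inr x) x.2,
    fun M _ a b => ?_⟩
  refine BoundedFormula.realize_restrictFreeVar (Sum.elim a b) ?_
  rintro ⟨x | x, hx⟩ <;> simp

/-- In a dependent theory every infinite indiscernible set is stable. -/
theorem IsDependent.isStableIndiscernibleSet {T : L.Theory} (hT : IsDependent T)
    (C : FirstOrder.Language.Theory.ModelType.{u, v, max u v} T) {ι : Type w} {I : Set (ι → C)}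
    (hinf : I.Infinite) (hI : IsIndiscernibleSet L I) : IsStableIndiscernibleSet L I := by
  refine ⟨hinf, hI, fun n φ b => ?_⟩
  by_contra hcon
  rw [not_or] at hcon
  obtain ⟨hP, hQ⟩ := hcon
  apply hT
  have hsub : ∀ {S : Set (ι → C)}, S ⊆ I → S.Infinite → ∀ N, ∃ p : Fin N ↪ I, ∀ k, (p k : ι → C) ∈ S := by
    intro S hS hSi N
    let g := hSi.natEmbedding
    exact ⟨⟨fun k => ⟨g k, hS (g k).2⟩, fun k l h =>
      Fin.ext (g.injective (Subtype.ext (congrArg (fun x : I => (x : ι → C)) h)))⟩, fun k => (g k).2⟩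
  let e := hinf.natEmbedding
  have hsh : ∀ (N : ℕ) (s : Set ℕ), ∃ b' : Fin n → C, ∀ k < N,
      φ.Realize (Sum.elim (e k : ι → C) b') ↔ k ∈ s := by
    intro N s
    obtain ⟨p, hp⟩ := hsub (fun a ha => ha.1) hP N
    obtain ⟨q, hq⟩ := hsub (fun a ha => ha.1) hQ N
    obtain ⟨b', hb'⟩ := hI.shatter φ b p q (fun k => (hp k).2) (fun k => (hq k).2)
      ((⟨Fin.val, Fin.val_injective⟩ : Fin N ↪ ℕ).trans e) {k | (k : ℕ) ∈ s}
    exact ⟨b', fun k hk => hb' ⟨k, hk⟩⟩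
  obtain ⟨m, d, ψ, hψ⟩ := exists_finite_support.{u, v, w, max u v, 0} φ
  -- One parameter tuple for every subset of ω simultaneously; finitely many conditions mention only
  -- indices below some bound, where `hsh` applies.
  let θ : Set ℕ × ℕ → L.Formula ((ℕ × Fin m) ⊕ (Set ℕ × Fin n)) := fun x =>
    ψ.relabel (Sum.map (fun i => (x.2, i)) (fun j => (x.1, j)))
  have hθ : ∀ (M : Type (max u v)) [L.Structure M] (a : ℕ × Fin m → M) (c : Set ℕ × Fin n → M) x,
      (θ x).Realize (Sum.elim a c) ↔
        ψ.Realize (Sum.elim (fun i => a (x.2, i)) (fun j => c (x.1, j))) := by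
    intro M _ a c x
    rw [FirstOrder.Language.Formula.realize_relabel, Sum.elim_comp_map]
    rfl
  classical
  let θ' := fun x : Set ℕ × ℕ => if x.2 ∈ x.1 then θ x else ∼(θ x)
  have hsat : FinSat T (Set.range θ') := by
    intro t ht htf
    rw [← Set.image_univ] at ht
    obtain ⟨F, -, hF, rfl⟩ := htf.exists_subset_finite_image_eq ht
    obtain ⟨N, hN⟩ := (hF.image Prod.snd).bddAbove
    choose c hc using hsh (N + 1)
    refine ⟨C, Sum.elim (fun i => (e i.1 : ι → C) (d i.2)) (fun j => c j.1 j.2), ?_⟩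
    rintro _ ⟨⟨s, k⟩, hx, rfl⟩
    have hk := hc s k (Nat.lt_succ_of_le (hN ⟨_, hx, rfl⟩))
    rw [← hψ C] at hk
    by_cases hks : k ∈ s
    · simp only [θ', hks, if_true, hθ]
      exact hk.2 hks
    · simp only [θ', hks, if_false, FirstOrder.Language.Formula.realize_not, hθ]
      exact fun h => hks (hk.1 h)
  obtain ⟨M, x, hx⟩ := hsat.exists_realize
  -- In `IsIndependent` the first tuple is the one indexed by subsets, so points and parameters
  -- exchange roles.
  refine ⟨M, n, m, ψ.relabel Sum.swap, fun s j => x (Sum.inr (s, j)),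
    fun k i => x (Sum.inl (k, i)), fun s k => ?_⟩
  have := hx _ ⟨(s, k), rfl⟩
  have hxe : x = Sum.elim (fun i => x (Sum.inl i)) (fun j => x (Sum.inr j)) :=
    (Sum.elim_comp_inl_inr x).symm
  rw [hxe] at this
  rw [FirstOrder.Language.Formula.realize_relabel, Sum.elim_swap]
  by_cases hk : k ∈ s
  · simpa [θ', hk, hθ] using this
  · simpa [θ', hk, hθ] using this

end Indiscernible

/-! ### Definable sets as fibers of ∅-definable ones -/

section Definability

variable {L : FirstOrder.Language.{u, v}} {M : Type w} [L.Structure M] {A : Set M}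
  {α : Type w'} {β : Type z}

open FirstOrder.Language in
/-- Fibers over parameters from `A` of an `A`-definable set are `A`-definable. -/
theorem _root_.Set.Definable.fiber {D : Set (α ⊕ β → M)} (hD : A.Definable L D) (d : α → M)
    (hd : ∀ a, d a ∈ A) : A.Definable L {w : β → M | Sum.elim d w ∈ D} := by
  obtain ⟨φ, rfl⟩ := hD
  refine ⟨φ.subst (Sum.elim (fun a => (L.con (⟨d a, hd a⟩ : A)).term) fun b => Term.var b), ?_⟩
  ext w
  simp only [Set.mem_ofPred_eq, Formula.Realize, BoundedFormula.realize_subst]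
  rw [iff_iff_eq]
  congr 1
  ext i
  rcases i with i | i <;> simp

/-- A set definable over `A` is a fiber of a `∅`-definable set over a finite tuple from `A`. -/
theorem _root_.Set.Definable.exists_fiber {D : Set (β → M)} (hD : A.Definable L D) :
    ∃ (n : ℕ) (d : Fin n → M) (E : Set (Fin n ⊕ β → M)), (∀ i, d i ∈ A) ∧
      (∅ : Set M).Definable L E ∧ D = {w | Sum.elim d w ∈ E} := by
  rw [Set.definable_iff_exists_formula_sum] at hD
  obtain ⟨φ, rfl⟩ := hD
  obtain ⟨m, e, ψ, hψ⟩ := exists_finite_support.{u, v, w, w, z} φ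
  refine ⟨m, fun i => e i, {v | ψ.Realize v}, fun i => (e i).2,
    Set.empty_definable_iff.2 ⟨ψ, rfl⟩, ?_⟩
  ext w
  exact (hψ M (fun a : A => (a : M)) w).symm

end Definability

/-! ### Realizing ultrafilters in saturated models; the uniform splitting bound -/

section Saturation

variable {L : FirstOrder.Language.{u, v}} {M : Type (max u v)} [L.Structure M]
  {κ : Cardinal.{max u v}}

open FirstOrder.Language in
/-- In a saturated model, the average type over a small set of an ultrafilter is realized. -/
theorem IsSaturated.exists_mem [Nonempty M] (h : IsSaturated L M κ) {A : Set M} (hA : #A < κ)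
    (U : Ultrafilter M) : ∃ d : M, ∀ D : Set M, A.Definable₁ L D → D ∈ U → d ∈ D := by
  let N := (U : Filter M).Product fun _ : M => M
  let f : M ↪ₑ[L] N := ⟨fun a => ((fun _ => a : M → M) : N), fun n φ x => by
    refine (Ultraproduct.realize_formula_cast (M := fun _ : M => M) (u := U) φ
      fun i _ => x i).trans ?_
    simp⟩
  -- The class of the identity in the ultrapower satisfies a formula exactly when the set it defines
  -- lies in `U`.
  let c : Fin 1 → N := fun _ => ((fun a => a : M → M) : N)
  obtain ⟨d, hd⟩ := h A hA N f c
  refine ⟨d 0, fun D hD hDU => ?_⟩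
  rw [Set.Definable₁, Set.definable_iff_exists_formula_sum] at hD
  obtain ⟨φ, hφ⟩ := hD
  have hφ' : ∀ x : Fin 1 → M, x 0 ∈ D ↔ φ.Realize (Sum.elim (fun a : A => (a : M)) x) :=
    fun x => Set.ext_iff.1 hφ x
  rw [hφ']
  change φ ∈ tp L (fun a : A => (a : M)) d
  rw [hd]
  change φ.Realize _
  have hc : Sum.elim (fun a : A => f (a : M)) c = fun i =>
      ((fun s => Sum.elim (fun (a : A) (_ : M) => (a : M)) (fun (_ : Fin 1) s => s) i s :
        M → M) : N) := by
    ext i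
    rcases i with i | i <;> rfl
  rw [hc]
  refine (Ultraproduct.realize_formula_cast (M := fun _ : M => M) (u := U) φ _).2 ?_
  filter_upwards [hDU] with x hx
  convert (hφ' fun _ => x).1 hx using 1
  ext i
  rcases i with i | i <;> rfl

/-- Coordinates are realized one at a time: dropping the last coordinate preserves definability over
`A`, so the fibers over the part already chosen have the finite intersection property. -/
theorem IsSaturated.exists_tuple_mem [Nonempty M] (hκ : ℵ₀ < κ) (h : IsSaturated L M κ)
    {A : Set M} (hA : #A < κ) {m : ℕ} (U : Ultrafilter (Fin m → M)) :
    ∃ d : Fin m → M, ∀ D : Set (Fin m → M), A.Definable L D → D ∈ U → d ∈ D := by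
  induction m with
  | zero =>
    refine ⟨default, fun D _ hD => ?_⟩
    obtain ⟨x, hx⟩ := U.nonempty_of_mem hD
    rwa [Subsingleton.elim default x]
  | succ m ih =>
    obtain ⟨d, hd⟩ := ih (U.map fun y => y ∘ Fin.castSucc)
    let S : Set (Set M) := {E | ∃ D : Set (Fin (m + 1) → M), A.Definable L D ∧ D ∈ U ∧
      E = {x | Fin.snoc (α := fun _ => M) d x ∈ D}}
    have hS : (Filter.generate S).NeBot := by
      rw [Filter.generate_neBot_iff]
      intro t ht htf
      have : ∃ D : Set (Fin (m + 1) → M), A.Definable L D ∧ D ∈ U ∧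
          {x | Fin.snoc (α := fun _ => M) d x ∈ D} ⊆ ⋂₀ t := by
        induction t, htf using Set.Finite.induction_on with
        | empty => exact ⟨Set.univ, Set.definable_univ, Filter.univ_mem, by simp⟩
        | @insert E t _ _ iht =>
          obtain ⟨D, hD, hDU, hDt⟩ := iht ((Set.subset_insert _ _).trans ht)
          obtain ⟨D', hD', hDU', rfl⟩ := ht (Set.mem_insert _ _)
          refine ⟨D' ∩ D, hD'.inter hD, Filter.inter_mem hDU' hDU, ?_⟩
          rw [Set.sInter_insert]
          exact fun x hx => ⟨hx.1, hDt hx.2⟩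
      obtain ⟨D, hD, hDU, hDt⟩ := this
      obtain ⟨y, hy, hyd⟩ := hd _ (hD.image_comp Fin.castSucc)
        (Ultrafilter.mem_map.2 (Filter.mem_of_superset hDU fun y hy => ⟨y, hy, rfl⟩))
      refine ⟨y (Fin.last m), hDt ?_⟩
      have : Fin.snoc (α := fun _ => M) d (y (Fin.last m)) = y := by
        rw [← hyd]
        exact Fin.snoc_init_self y
      simpa only [Set.mem_ofPred_eq, this] using hy
    have hA' : #(A ∪ Set.range d : Set M) < κ :=
      (Cardinal.mk_union_le _ _).trans_lt (Cardinal.add_lt_of_lt hκ.le hA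
        ((Cardinal.mk_le_aleph0_iff.2 (Set.countable_range d).to_subtype).trans_lt hκ))
    obtain ⟨x, hx⟩ := h.exists_mem hA' (Ultrafilter.of (Filter.generate S))
    refine ⟨Fin.snoc (α := fun _ => M) d x, fun D hD hDU => ?_⟩
    refine hx {x | Fin.snoc (α := fun _ => M) d x ∈ D} ?_
      (Ultrafilter.of_le _ (Filter.mem_generate_of_mem ⟨D, hD, hDU, rfl⟩))
    have := ((hD.mono (Set.subset_union_left (t := Set.range d))).preimage_comp
      (finSumFinEquiv (m := m) (n := 1)).symm).fiber d fun a => Or.inr ⟨a, rfl⟩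
    change (A ∪ Set.range d).Definable L
      {w : Fin 1 → M | Fin.snoc (α := fun _ => M) d (w 0) ∈ D}
    convert this using 1
    ext w
    simp only [Set.mem_ofPred_eq, Set.mem_preimage]
    rw [iff_iff_eq]
    congr 1
    ext i
    refine Fin.lastCases ?_ (fun i => ?_) i
    · have hlast : (Fin.last m) = finSumFinEquiv (Sum.inr (0 : Fin 1)) := rfl
      rw [Fin.snoc_last, Function.comp_apply, hlast, Equiv.symm_apply_apply]
      rfl
    · simp [finSumFinEquiv, Fin.addCases]

/-- A formula splits a stable indiscernible set of a saturated model in a uniform way. -/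
theorem IsStableIndiscernibleSet.exists_bound [Nonempty M] (hκ : ℵ₀ < κ) (h : IsSaturated L M κ)
    {I : Set (Fin 1 → M)} (hI : IsStableIndiscernibleSet L I) {m : ℕ}
    (φ : L.Formula (Fin 1 ⊕ Fin m)) :
    ∃ n : ℕ, ∀ b : Fin m → M, ¬ ((∃ p : Fin n ↪ I, ∀ k, φ.Realize (Sum.elim (p k : Fin 1 → M) b)) ∧
      ∃ q : Fin n ↪ I, ∀ k, ¬ φ.Realize (Sum.elim (q k : Fin 1 → M) b)) := by
  by_contra! hcon
  obtain ⟨hinf, hind, hst⟩ := hI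
  let e := hinf.natEmbedding
  -- Parity stands for any infinite coinfinite pattern: a limit of the `b N`, which saturation
  -- provides, splits `I` into two infinite parts.
  have hb : ∀ N : ℕ, ∃ b : Fin m → M, ∀ k < N, φ.Realize (Sum.elim (e k : Fin 1 → M) b) ↔ Even k := by
    intro N
    obtain ⟨b, ⟨p, hp⟩, q, hq⟩ := hcon N
    obtain ⟨b', hb'⟩ := hind.shatter φ b p q hp hq
      ((⟨Fin.val, Fin.val_injective⟩ : Fin N ↪ ℕ).trans e) {k | Even (k : ℕ)}
    exact ⟨b', fun k hk => hb' ⟨k, hk⟩⟩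
  choose b hb using hb
  obtain ⟨d, hd⟩ := h.exists_tuple_mem hκ (A := Set.range fun k => (e k : Fin 1 → M) 0)
    ((Cardinal.mk_le_aleph0_iff.2 (Set.countable_range _).to_subtype).trans_lt hκ)
    ((Ultrafilter.of (Filter.atTop : Filter ℕ)).map b)
  have hd' : ∀ k, φ.Realize (Sum.elim (e k : Fin 1 → M) d) ↔ Even k := by
    intro k
    have hdef : (Set.range fun k => (e k : Fin 1 → M) 0).Definable L
        {c : Fin m → M | φ.Realize (Sum.elim (e k : Fin 1 → M) c)} :=
      Set.Definable.fiber (D := {v | φ.Realize v})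
        ((Set.empty_definable_iff.2 ⟨φ, rfl⟩).mono (Set.empty_subset _)) _
        (fun a => ⟨k, by rw [Subsingleton.elim a 0]⟩)
    have hmem : {c : Fin m → M | φ.Realize (Sum.elim (e k : Fin 1 → M) c) ↔ Even k} ∈
        (Ultrafilter.of (Filter.atTop : Filter ℕ)).map b := by
      refine Ultrafilter.of_le Filter.atTop ?_
      filter_upwards [Filter.eventually_gt_atTop k] with N hN
      exact hb N k hN
    by_cases hk : Even k
    · simp only [hk, iff_true] at hmem ⊢
      exact hd _ hdef hmem
    · simp only [hk, iff_false] at hmem ⊢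
      exact hd _ hdef.compl hmem
  have hinj : Function.Injective fun k => (e k : Fin 1 → M) :=
    Subtype.val_injective.comp e.injective
  rcases hst m φ d with h | h
  · refine Set.infinite_of_injective_forall_mem (f := fun k : ℕ => (e (2 * k) : Fin 1 → M))
      (fun k l hkl => ?_) (fun k => ?_) h
    · have := hinj hkl
      omega
    · exact ⟨(e (2 * k)).2, (hd' _).2 (by simp)⟩
  · refine Set.infinite_of_injective_forall_mem (f := fun k : ℕ => (e (2 * k + 1) : Fin 1 → M))
      (fun k l hkl => ?_) (fun k => ?_) h
    · have := hinj hkl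
      omega
    · exact ⟨(e (2 * k + 1)).2, fun h => by simpa using (hd' _).1 h⟩

end Saturation

/-! ### Good tuples and good sets -/

section Good

variable {L : FirstOrder.Language.{u, v}} {N : Type w} [L.Structure N] {J A : Set N}

variable (L J) in
/-- The tuple `d` is good over `J` if every `∅`-definable relation between `d` and the elements of
`J` is decided, uniformly for almost all elements of `J`, by the type of `d` over `J`. -/
def Good {α : Type} (d : α → N) : Prop :=
  ∀ R : Set (α ⊕ Fin 1 → N), (∅ : Set N).Definable L R →
    ∃ S : Set (α → N), J.Definable L S ∧ d ∈ S ∧ ∃ F : Set N, F.Finite ∧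
      ((∀ z ∈ S, ∀ j ∈ J \ F, Sum.elim z (fun _ => j) ∈ R) ∨
        ∀ z ∈ S, ∀ j ∈ J \ F, Sum.elim z (fun _ => j) ∉ R)

theorem Good.comp {α β : Type} [Finite α] [Finite β] {d : β → N} (hd : Good L J d) (g : α → β) :
    Good L J (d ∘ g) := by
  intro R hR
  obtain ⟨S, hS, hdS, F, hF, h⟩ := hd _ (hR.preimage_comp (Sum.map g id))
  refine ⟨_, hS.image_comp g, ⟨d, hdS, rfl⟩, F, hF, ?_⟩
  refine h.imp (fun h => ?_) fun h => ?_
  all_goals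
    rintro _ ⟨z, hz, rfl⟩ j hj
    have := h z hz j hj
    rwa [Set.mem_preimage, Sum.elim_comp_map] at this

variable (L J A) in
/-- A set is good over `J` if all its finite tuples are. -/
def GoodSet : Prop :=
  ∀ (n : ℕ) (d : Fin n → N), (∀ i, d i ∈ A) → Good L J d

theorem GoodSet.good (hA : GoodSet L J A) {α : Type} [Finite α] (d : α → N) (hd : ∀ i, d i ∈ A) :
    Good L J d := by
  obtain ⟨n, ⟨e⟩⟩ := Finite.exists_equiv_fin α
  have := (hA n (d ∘ e.symm) fun i => hd _).comp e
  rwa [Function.comp_assoc, Equiv.symm_comp_self, Function.comp_id] at this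

theorem GoodSet.mono {B : Set N} (hA : GoodSet L J A) (h : B ⊆ A) : GoodSet L J B :=
  fun n d hd => hA n d fun i => h (hd i)

theorem GoodSet.of_finite (h : ∀ t ⊆ A, t.Finite → GoodSet L J t) : GoodSet L J A :=
  fun n d hd => h (Set.range d) (Set.range_subset_iff.2 hd) (Set.finite_range d) n d
    fun i => ⟨i, rfl⟩

/-- A tuple from `insert c A` is a reindexing of a tuple from `A` followed by `c`; `a` fills the
coordinates outside `A`. -/
theorem goodSet_insert {c a : N} (ha : a ∈ A)
    (h : ∀ (n : ℕ) (d : Fin n → N), (∀ i, d i ∈ A) →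
      Good L J (Sum.elim d (fun _ : Fin 1 => c))) : GoodSet L J (insert c A) := by
  classical
  intro n d hd
  let d' : Fin n → N := fun i => if d i ∈ A then d i else a
  let g : Fin n → Fin n ⊕ Fin 1 := fun i => if d i ∈ A then Sum.inl i else Sum.inr 0
  have hd' : ∀ i, d' i ∈ A := fun i => by
    by_cases hi : d i ∈ A <;> simp [d', hi, ha]
  have : d = Sum.elim d' (fun _ : Fin 1 => c) ∘ g := by
    ext i
    by_cases hi : d i ∈ A
    · simp [g, d', hi]
    · simpa [g, d', hi] using (hd i).resolve_right hi
  rw [this]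
  exact (h n d' hd').comp g

theorem definable_singleton_tuple {α : Type} [Finite α] (d : α → N) (hd : ∀ i, d i ∈ A) :
    A.Definable L {d} := by
  have : ({d} : Set (α → N)) = ⋂ i, {z | z i ∈ ({d i} : Set N)} := by
    ext z
    simp [funext_iff]
  rw [this]
  refine Set.definable_iInter_of_finite fun i => ?_
  exact (Set.Definable.singleton_of_mem L (hd i)).preimage_comp (fun _ : Fin 1 => i)

/-- An indiscernible set is good over itself. -/
theorem goodSet_self (h : ∀ (n : ℕ) (d : Fin n → N) (j j' : N), (∀ i, d i ∈ J) →
    j ∈ J \ Set.range d → j' ∈ J \ Set.range d →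
    ∀ R : Set (Fin n ⊕ Fin 1 → N), (∅ : Set N).Definable L R →
      Sum.elim d (fun _ => j) ∈ R → Sum.elim d (fun _ => j') ∈ R) : GoodSet L J J := by
  intro n d hd R hR
  refine ⟨{d}, definable_singleton_tuple d hd, rfl, Set.range d, Set.finite_range d, ?_⟩
  by_contra! hcon
  obtain ⟨⟨z, rfl, j, hj, hjR⟩, z', rfl, j', hj', hjR'⟩ := hcon
  exact hjR (h n _ j' j hd hj' hj R hR hjR')

end Good

/-! ### Generated filters as partial types; a pigeonhole -/

section Generate

variable {X : Type w}

theorem neBot_generate_insert {s : Set (Set X)} {a : Set X} (ha : aᶜ ∉ Filter.generate s) :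
    (Filter.generate (insert a s)).NeBot := by
  rw [Filter.generate_neBot_iff]
  intro t ht htf
  by_contra hcon
  rw [Set.not_nonempty_iff_eq_empty] at hcon
  refine ha (Filter.mem_generate_iff.2 ⟨t \ {a}, ?_, htf.subset Set.sdiff_subset, ?_⟩)
  · rintro x ⟨hx, hxa⟩
    exact (ht hx).resolve_left hxa
  · intro x hx hxa
    have : x ∈ ⋂₀ t := fun b hb => by
      by_cases hba : b = a
      · exact hba ▸ hxa
      · exact hx b ⟨hb, hba⟩
    simp [hcon] at this

theorem mem_of_mem_generate {s : Set (Set X)} {c : X} (hc : ∀ D ∈ s, c ∈ D) {D : Set X}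
    (hD : D ∈ Filter.generate s) : c ∈ D := by
  obtain ⟨t, ht, -, h⟩ := Filter.mem_generate_iff.1 hD
  exact h fun b hb => hc b (ht hb)

/-- A map from a set of size `κ` to the finite subsets of a set of size `< κ` has an infinite
fiber. -/
theorem exists_infinite_fiber {Y Z : Type w} {κ : Cardinal.{w}} (hκ : ℵ₀ < κ) (hY : κ ≤ #Y)
    (hZ : #Z < κ) (f : Y → Finset Z) : ∃ t, (f ⁻¹' {t}).Infinite := by
  -- The dummy factor ℕ makes the target infinite, so a fiber larger than the target is infinite.
  have h1 : #(Finset Z × ULift.{w} ℕ) < #Y := by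
    refine lt_of_lt_of_le ?_ hY
    rw [Cardinal.mk_prod, Cardinal.lift_id, Cardinal.lift_id]
    refine Cardinal.mul_lt_of_lt hκ.le ?_ (by simpa using hκ)
    cases finite_or_infinite Z
    · exact (Cardinal.mk_lt_aleph0).trans hκ
    · rwa [Cardinal.mk_finset_of_infinite]
  obtain ⟨⟨t, n⟩, h⟩ := Cardinal.infinite_pigeonhole_card_lt
    (fun y => ((f y, ⟨0⟩) : Finset Z × ULift.{w} ℕ)) h1 (hκ.le.trans hY)
  refine ⟨t, ?_⟩
  have h2 : ((fun y => ((f y, ⟨0⟩) : Finset Z × ULift.{w} ℕ)) ⁻¹' {(t, n)}).Infinite := by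
    rw [← Set.infinite_coe_iff, Cardinal.infinite_iff]
    exact (Cardinal.infinite_iff.1 inferInstance).trans h.le
  exact h2.mono fun y hy => show f y = t from congrArg Prod.fst hy

end Generate

/-! ### From pointwise decisions to a uniform `J`-definable condition -/

section Step

variable {L : FirstOrder.Language.{u, v}} {N : Type w} [L.Structure N] {J A : Set N}

theorem definable_sInter {q : Set (Set N)} (hq : ∀ D ∈ q, A.Definable₁ L D) (t : Finset q) :
    A.Definable₁ L (⋂ D ∈ t, (D : Set N)) := by
  have := Set.definable_biInter_finset (f := fun D : q => {x : Fin 1 → N | x 0 ∈ (D : Set N)})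
    (fun D => hq D D.2) t
  refine (congrArg (A.Definable L) ?_).mp this
  ext x
  simp

/-- If a family of `A`-definable sets decides a relation with almost all members of `J`, then a
`J`-definable relation does. -/
theorem GoodSet.exists_uniform {κ : Cardinal.{w}} (hκ : ℵ₀ < κ) (hJ : κ ≤ #J)
    (hA : GoodSet L J A) {q : Set (Set N)} (hq : ∀ D ∈ q, A.Definable₁ L D) (hqκ : #q < κ)
    {n : ℕ} {d : Fin n → N} (hd : ∀ i, d i ∈ A)
    {R : Set ((Fin n ⊕ Fin 1) ⊕ Fin 1 → N)} (hR : (∅ : Set N).Definable L R) {F : Set N}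
    (hF : F.Finite)
    (h : ∀ j ∈ J \ F, {x | Sum.elim (Sum.elim d (fun _ => x)) (fun _ => j) ∈ R} ∈
      Filter.generate q) :
    ∃ S : Set (Fin n ⊕ Fin 1 → N), J.Definable L S ∧
      {x | Sum.elim d (fun _ => x) ∈ S} ∈ Filter.generate q ∧ ∃ F' : Set N, F'.Finite ∧
        ∀ z ∈ S, ∀ j ∈ J \ F', Sum.elim z (fun _ => j) ∈ R := by
  classical
  have h1 : ∀ j : ↥(J \ F), ∃ t : Finset q, (⋂ D ∈ t, (D : Set N)) ⊆
      {x | Sum.elim (Sum.elim d (fun _ => x)) (fun _ => (j : N)) ∈ R} := by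
    intro j
    obtain ⟨t, ht, htf, hts⟩ := Filter.mem_generate_iff.1 (h j j.2)
    lift t to Finset (Set N) using htf
    refine ⟨t.subtype _, fun x hx => hts fun D hD => ?_⟩
    simp only [Finset.mem_subtype, Set.mem_iInter] at hx
    exact hx ⟨D, ht hD⟩ hD
  choose t ht using h1
  have hJF : κ ≤ #↥(J \ F) := by
    by_contra! hlt
    refine hJ.not_gt (lt_of_le_of_lt (Cardinal.mk_le_mk_of_subset (t := J \ F ∪ F) ?_)
      ((Cardinal.mk_union_le _ _).trans_lt (Cardinal.add_lt_of_lt hκ.le hlt ?_)))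
    · intro x hx
      by_cases hxF : x ∈ F
      · exact Or.inr hxF
      · exact Or.inl ⟨hx, hxF⟩
    · have := hF.to_subtype
      exact Cardinal.mk_lt_aleph0.trans hκ
  -- Each `j` uses a finite part of `q`; there are fewer than κ finite parts, so one of them serves
  -- infinitely many `j`.
  obtain ⟨t₀, ht₀⟩ := exists_infinite_fiber hκ hJF hqκ t
  obtain ⟨m, b, E, hb, hE, hDE⟩ := (definable_sInter hq t₀).exists_fiber
  have hD : ∀ x, x ∈ (⋂ D ∈ t₀, (D : Set N)) ↔ Sum.elim b (fun _ : Fin 1 => x) ∈ E :=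
    fun x => Set.ext_iff.1 hDE fun _ => x
  -- `G(z, w, j)` says that `E(w, x)` implies `R(z, x, j)` for all `x`. It no longer mentions the
  -- new point, so goodness of `A` applies to it at `(d, b)`.
  let G : Set ((Fin n ⊕ Fin m) ⊕ Fin 1 → N) := {v | ∀ x : Fin 1 → N, Sum.elim v x ∈
    {y : ((Fin n ⊕ Fin m) ⊕ Fin 1) ⊕ Fin 1 → N |
      y ∘ Sum.elim (fun i => Sum.inl (Sum.inl (Sum.inr i))) Sum.inr ∈ E}ᶜ ∪
    {y : ((Fin n ⊕ Fin m) ⊕ Fin 1) ⊕ Fin 1 → N |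
      y ∘ Sum.elim (Sum.elim (fun i => Sum.inl (Sum.inl (Sum.inl i))) Sum.inr)
        (fun i => Sum.inl (Sum.inr i)) ∈ R}}
  have hG : (∅ : Set N).Definable L G :=
    ((hE.preimage_comp _).compl.union (hR.preimage_comp _)).forall_of_finite
  have hGm : ∀ (z : Fin n → N) (w : Fin m → N) (j : N),
      Sum.elim (Sum.elim z w) (fun _ => j) ∈ G ↔ ∀ x : N, Sum.elim w (fun _ => x) ∈ E →
        Sum.elim (Sum.elim z (fun _ => x)) (fun _ => j) ∈ R := by
    intro z w j
    have hx : ∀ x : Fin 1 → N, x = fun _ => x 0 := fun x => by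
      ext i
      rw [Subsingleton.elim i 0]
    have h1 : ∀ x : Fin 1 → N, Sum.elim (Sum.elim (Sum.elim z w) (fun _ : Fin 1 => j)) x ∘
        Sum.elim (fun i => Sum.inl (Sum.inl (Sum.inr i))) Sum.inr = Sum.elim w x := fun x => by
      ext (i | i) <;> rfl
    have h2 : ∀ x : Fin 1 → N, Sum.elim (Sum.elim (Sum.elim z w) (fun _ : Fin 1 => j)) x ∘
        Sum.elim (Sum.elim (fun i => Sum.inl (Sum.inl (Sum.inl i))) Sum.inr)
          (fun i => Sum.inl (Sum.inr i)) = Sum.elim (Sum.elim z x) (fun _ => j) := fun x => by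
      ext ((i | i) | i) <;> rfl
    simp only [G, Set.mem_ofPred_eq, Set.mem_union, Set.mem_compl_iff, h1, h2]
    constructor
    · exact fun h x hxE => (h fun _ => x).resolve_left (not_not_intro hxE)
    · intro h x
      rw [or_iff_not_imp_left, not_not, hx x]
      exact h (x 0)
  obtain ⟨S, hS, hdS, F', hF', hSF⟩ := hA.good (Sum.elim d b)
    (by rintro (i | i) <;> simp [hd, hb]) G hG
  have hSF : ∀ z ∈ S, ∀ j ∈ J \ F', Sum.elim z (fun _ => j) ∈ G := by
    -- The negative alternative fails at any of the infinitely many `j` served by `t₀` that lie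
    -- outside `F'`.
    refine hSF.resolve_right fun hneg => ?_
    obtain ⟨_, ⟨j, hj, rfl⟩, hjF⟩ := ((ht₀.image Subtype.val_injective.injOn).sdiff hF').nonempty
    refine hneg _ hdS j ⟨j.2.1, hjF⟩ ((hGm d b j).2 fun x hx => ?_)
    refine ht j ?_
    rw [show t j = t₀ from hj]
    exact (hD x).2 hx
  -- Quantifying over `w` removes the parameters `b`, leaving a set definable over `J` alone.
  refine ⟨{v | ∃ w : Fin m → N, Sum.elim v w ∈
    {y : (Fin n ⊕ Fin 1) ⊕ Fin m → N |
      y ∘ Sum.elim (fun i => Sum.inl (Sum.inl i)) Sum.inr ∈ S} ∩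
    {y : (Fin n ⊕ Fin 1) ⊕ Fin m → N |
      y ∘ Sum.elim Sum.inr (fun i => Sum.inl (Sum.inr i)) ∈ E}},
    ((hS.preimage_comp _).inter
      ((hE.mono (Set.empty_subset _)).preimage_comp _)).exists_of_finite, ?_, F', hF', ?_⟩
  · refine Filter.mem_of_superset (x := ⋂ D ∈ t₀, (D : Set N)) ?_ fun x hx => ⟨b, ?_, ?_⟩
    · exact (Filter.biInter_finset_mem t₀).2 fun D _ => Filter.mem_generate_of_mem D.2
    · change _ ∈ S
      convert hdS using 1
      ext (i | i) <;> rfl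
    · change _ ∈ E
      convert (hD x).1 hx using 1
      ext (i | i) <;> rfl
  · rintro v ⟨w, hvS, hvE⟩ j hj
    have h1 := hSF _ hvS j hj
    have h2 : Sum.elim v w ∘ Sum.elim (fun i => Sum.inl (Sum.inl i)) Sum.inr =
        Sum.elim (v ∘ Sum.inl) w := by
      ext (i | i) <;> rfl
    rw [h2, hGm] at h1
    have h3 := h1 (v (Sum.inr 0)) ?_
    · convert h3 using 1
      ext ((i | i) | i)
      · rfl
      · rw [Subsingleton.elim i 0]; rfl
      · rfl
    · convert (show _ ∈ E from hvE) using 1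
      ext (i | i)
      · rfl
      · rw [Subsingleton.elim i 0]; rfl

end Step

/-! ### Deciding a relation with almost all of `J` by finitely many formulas -/

/-- If no point splits `J` in two parts of size `k`, then a filter base can be extended by finitely
many members or complements of members of the family so that almost all of it is decided. -/
theorem exists_decided {X : Type w} {J : Set X} {q : Set (Set X)} (hq : (Filter.generate q).NeBot)
    (R : X → Set X) {k : ℕ} (hk : ∀ (x : X) (P Q : Finset X), (P : Set X) ⊆ J → (Q : Set X) ⊆ J →
      (∀ j ∈ P, x ∈ R j) → (∀ j ∈ Q, x ∉ R j) → P.card < k ∨ Q.card < k) :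
    ∃ Δ : Set (Set X), Δ.Finite ∧ (∀ D ∈ Δ, ∃ j ∈ J, D = R j ∨ D = (R j)ᶜ) ∧
      (Filter.generate (q ∪ Δ)).NeBot ∧ ∃ F : Set X, F.Finite ∧
        ((∀ j ∈ J \ F, R j ∈ Filter.generate (q ∪ Δ)) ∨
          ∀ j ∈ J \ F, (R j)ᶜ ∈ Filter.generate (q ∪ Δ)) := by
  classical
  -- While nothing is decided, each round consistently adds some `R i` with `i` new to `P` and some
  -- complement `(R j)ᶜ` with `j` new to `Q`. After `k` rounds a point of the finite intersection
  -- contradicts `hk`.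
  by_contra! hcon
  have key : ∀ n : ℕ, ∃ (Δ : Set (Set X)) (P Q : Finset X), Δ.Finite ∧
      (∀ D ∈ Δ, ∃ j ∈ J, D = R j ∨ D = (R j)ᶜ) ∧ (Filter.generate (q ∪ Δ)).NeBot ∧
      (P : Set X) ⊆ J ∧ (Q : Set X) ⊆ J ∧ P.card = n ∧ Q.card = n ∧
      (∀ j ∈ P, R j ∈ Δ) ∧ ∀ j ∈ Q, (R j)ᶜ ∈ Δ := by
    intro n
    induction n with
    | zero => exact ⟨∅, ∅, ∅, by simpa using hq⟩
    | succ n ih =>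
      obtain ⟨Δ, P, Q, hΔ, hΔR, hne, hP, hQ, hPn, hQn, hPR, hQR⟩ := ih
      obtain ⟨-, i, hi, hiR⟩ := hcon Δ hΔ hΔR hne P P.finite_toSet
      have hne₁ : (Filter.generate (q ∪ insert (R i) Δ)).NeBot := by
        rw [Set.union_insert]
        exact neBot_generate_insert hiR
      have hΔR₁ : ∀ D ∈ insert (R i) Δ, ∃ j ∈ J, D = R j ∨ D = (R j)ᶜ := by
        rintro D (rfl | hD)
        · exact ⟨i, hi.1, Or.inl rfl⟩
        · exact hΔR D hD
      obtain ⟨⟨j, hj, hjR⟩, -⟩ := hcon _ (hΔ.insert _) hΔR₁ hne₁ Q Q.finite_toSet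
      refine ⟨insert (R j)ᶜ (insert (R i) Δ), insert i P, insert j Q, (hΔ.insert _).insert _, ?_,
        ?_, ?_, ?_, ?_, ?_, ?_, ?_⟩
      · rintro D (rfl | hD)
        · exact ⟨j, hj.1, Or.inr rfl⟩
        · exact hΔR₁ D hD
      · rw [Set.union_insert]
        exact neBot_generate_insert (by rwa [compl_compl])
      · rw [Finset.coe_insert]
        exact Set.insert_subset hi.1 hP
      · rw [Finset.coe_insert]
        exact Set.insert_subset hj.1 hQ
      · rw [Finset.card_insert_of_notMem hi.2, hPn]
      · rw [Finset.card_insert_of_notMem hj.2, hQn]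
      · intro l hl
        rcases Finset.mem_insert.1 hl with rfl | hl
        · exact Or.inr (Or.inl rfl)
        · exact Or.inr (Or.inr (hPR l hl))
      · intro l hl
        rcases Finset.mem_insert.1 hl with rfl | hl
        · exact Or.inl rfl
        · exact Or.inr (Or.inr (hQR l hl))
  obtain ⟨Δ, P, Q, hΔ, hΔR, hne, hP, hQ, hPn, hQn, hPR, hQR⟩ := key k
  have h1 : (⋂₀ Δ) ∈ Filter.generate (q ∪ Δ) :=
    (Filter.sInter_mem hΔ).2 fun D hD => Filter.mem_generate_of_mem (Or.inr hD)
  obtain ⟨x, hx⟩ := hne.nonempty_of_mem h1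
  have := hk x P Q hP hQ (fun j hj => hx _ (hPR j hj)) fun j hj => hx _ (hQR j hj)
  omega

section Extension

variable {L : FirstOrder.Language.{u, v}} {N : Type w} [L.Structure N] {J A : Set N}

variable (L J) in
/-- Every definable family splits `J` in two parts one of which has bounded size. -/
def SplitBound : Prop :=
  ∀ (α : Type) [Finite α] (R : Set (α ⊕ Fin 1 → N)), (∅ : Set N).Definable L R →
    ∃ k : ℕ, ∀ (z : α → N) (P Q : Finset N), (P : Set N) ⊆ J → (Q : Set N) ⊆ J →
      (∀ j ∈ P, Sum.elim z (fun _ => j) ∈ R) → (∀ j ∈ Q, Sum.elim z (fun _ => j) ∉ R) →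
      P.card < k ∨ Q.card < k

theorem GoodSet.exists_decided {κ : Cardinal.{w}} (hκ : ℵ₀ < κ) (hJ : κ ≤ #J) (hJA : J ⊆ A)
    (hsplit : SplitBound L J)
    (hA : GoodSet L J A) {q : Set (Set N)} (hq : ∀ D ∈ q, A.Definable₁ L D) (hqκ : #q < κ)
    (hqne : (Filter.generate q).NeBot) {n : ℕ} {d : Fin n → N} (hd : ∀ i, d i ∈ A)
    {R : Set ((Fin n ⊕ Fin 1) ⊕ Fin 1 → N)} (hR : (∅ : Set N).Definable L R) :
    ∃ Δ : Set (Set N), Δ.Finite ∧ (∀ D ∈ Δ, A.Definable₁ L D) ∧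
      (Filter.generate (q ∪ Δ)).NeBot ∧
      ∃ S : Set (Fin n ⊕ Fin 1 → N), J.Definable L S ∧
        {x | Sum.elim d (fun _ => x) ∈ S} ∈ Filter.generate (q ∪ Δ) ∧ ∃ F : Set N, F.Finite ∧
        ((∀ z ∈ S, ∀ j ∈ J \ F, Sum.elim z (fun _ => j) ∈ R) ∨
          ∀ z ∈ S, ∀ j ∈ J \ F, Sum.elim z (fun _ => j) ∉ R) := by
  obtain ⟨k, hk⟩ := hsplit _ R hR
  obtain ⟨Δ, hΔ, hΔR, hne, F, hF, h⟩ := ExactSat.exists_decided hqne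
    (fun j => {x | Sum.elim (Sum.elim d (fun _ => x)) (fun _ => j) ∈ R}) (J := J) (k := k)
    fun x P Q => hk (Sum.elim d fun _ => x) P Q
  have hRd : ∀ j ∈ J, A.Definable₁ L
      {x | Sum.elim (Sum.elim d (fun _ => x)) (fun _ => j) ∈ R} := by
    intro j hj
    have := ((hR.mono (Set.empty_subset A)).preimage_comp
      (Sum.elim (Sum.elim (fun i => Sum.inl (Sum.inl i)) Sum.inr) (fun i => Sum.inl (Sum.inr i)) :
        (Fin n ⊕ Fin 1) ⊕ Fin 1 → (Fin n ⊕ Fin 1) ⊕ Fin 1)).fiber (Sum.elim d fun _ => j)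
      (by rintro (i | i) <;> simp [hd, hJA hj])
    change A.Definable L {x : Fin 1 → N | _ ∈ R}
    convert this using 1
    ext x
    simp only [Set.mem_ofPred_eq, Set.mem_preimage]
    rw [iff_iff_eq]
    congr 1
    ext ((i | i) | i)
    · rfl
    · rw [Subsingleton.elim i 0]; rfl
    · rfl
  have hΔA : ∀ D ∈ Δ, A.Definable₁ L D := by
    intro D hD
    obtain ⟨j, hj, rfl | rfl⟩ := hΔR D hD
    · exact hRd j hj
    · exact (hRd j hj).compl
  have hqΔ : #(q ∪ Δ : Set (Set N)) < κ := by
    have := hΔ.to_subtype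
    exact (Cardinal.mk_union_le _ _).trans_lt
      (Cardinal.add_lt_of_lt hκ.le hqκ (Cardinal.mk_lt_aleph0.trans hκ))
  have hqA : ∀ D ∈ q ∪ Δ, A.Definable₁ L D := fun D hD => hD.elim (hq D) (hΔA D)
  refine ⟨Δ, hΔ, hΔA, hne, ?_⟩
  rcases h with h | h
  · obtain ⟨S, hS, hdS, F', hF', hSF⟩ := hA.exists_uniform hκ hJ hqA hqΔ hd hR hF h
    exact ⟨S, hS, hdS, F', hF', Or.inl hSF⟩
  · obtain ⟨S, hS, hdS, F', hF', hSF⟩ := hA.exists_uniform hκ hJ hqA hqΔ hd hR.compl hF h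
    exact ⟨S, hS, hdS, F', hF', Or.inr hSF⟩

end Extension

/-! ### Counting formulas and definable sets -/

section Cardinality

theorem mk_formula_le (L : FirstOrder.Language.{u, v}) (α : Type z) :
    #(L.Formula α) ≤ max ℵ₀ (Cardinal.lift.{max u v} #α + Cardinal.lift.{z} L.card) :=
  (Cardinal.mk_le_of_injective (f := fun φ : L.Formula α =>
    (⟨0, φ⟩ : Σ n, L.BoundedFormula α n)) fun _ _ h => by simpa using h).trans
    FirstOrder.Language.BoundedFormula.card_le

end Cardinality

section Cardinality

theorem mk_Iio_ord_toType_lt {κ : Cardinal.{w}} (i : κ.ord.ToType) : #(Set.Iio i) < κ :=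
  (Cardinal.mk_Iio_lt i (by simp)).trans_eq (Cardinal.mk_ord_toType κ)

theorem mk_sigma_nat_le {f : ℕ → Type w} {κ : Cardinal.{w}} (hκ : ℵ₀ ≤ κ)
    (h : ∀ n, #(f n) ≤ κ) : #(Σ n, f n) ≤ κ := by
  rw [Cardinal.mk_sigma]
  refine (Cardinal.sum_le_lift_mk_mul_iSup _).trans ?_
  refine Cardinal.mul_le_of_le hκ (by simpa using hκ) (ciSup_le' h)

theorem mk_fin_arrow_le {X : Type w} {κ : Cardinal.{w}} (hκ : ℵ₀ ≤ κ) (h : #X ≤ κ) (n : ℕ) :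
    #(Fin n → X) ≤ κ := by
  simp only [Cardinal.mk_pi, Cardinal.prod_const, Cardinal.mk_fin, Cardinal.lift_natCast,
    Cardinal.lift_uzero, Cardinal.power_natCast]
  exact (pow_le_pow_left' h n).trans (Cardinal.power_nat_le hκ)

variable {L : FirstOrder.Language.{u, v}} {κ : Cardinal.{max u v}}

theorem mk_formula_le_of_theoryCard_le (hκ : theoryCard L ≤ κ) {α : Type (max u v)} (hα : #α ≤ κ) :
    #(L.Formula α) ≤ κ := by
  have h0 : ℵ₀ ≤ κ := (le_max_right _ _).trans hκ
  refine (mk_formula_le L α).trans (max_le h0 ?_)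
  rw [Cardinal.lift_id, Cardinal.lift_id]
  exact Cardinal.add_le_of_le h0 hα ((le_max_left _ _).trans hκ)

theorem mk_formula_finite_le (hκ : theoryCard L ≤ κ) (α : Type) [Finite α] :
    #(L.Formula α) ≤ κ := by
  have h0 : ℵ₀ ≤ κ := (le_max_right _ _).trans hκ
  refine (mk_formula_le L α).trans (max_le h0 ?_)
  rw [Cardinal.lift_uzero]
  exact Cardinal.add_le_of_le h0
    ((Cardinal.lift_le_aleph0.2 Cardinal.mk_le_aleph0).trans h0)
    ((le_max_left _ _).trans hκ)

theorem mk_definable_le {N : Type (max u v)} [L.Structure N] (hκ : theoryCard L ≤ κ) (α : Type) [Finite α] :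
    #{R : Set (α → N) // (∅ : Set N).Definable L R} ≤ κ := by
  have h : Function.Surjective fun φ : L.Formula α =>
      (⟨{x | φ.Realize x}, Set.empty_definable_iff.2 ⟨φ, rfl⟩⟩ :
        {R : Set (α → N) // (∅ : Set N).Definable L R}) := by
    rintro ⟨R, hR⟩
    obtain ⟨φ, rfl⟩ := Set.empty_definable_iff.1 hR
    exact ⟨φ, rfl⟩
  exact (Cardinal.mk_le_of_surjective h).trans (mk_formula_finite_le hκ α)

end Cardinality

/-! ### Adding a realization while staying good -/

section Extension

variable {L : FirstOrder.Language.{u, v}} {N : Type (max u v)} [L.Structure N] {J A U : Set N}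
  {κ : Cardinal.{max u v}}

/-- A small family of `A`-definable sets with the finite intersection property is realized by a
point whose adjunction to `A` keeps `A` good. -/
theorem GoodSet.exists_insert (hκ : theoryCard L < κ) (hJ : κ ≤ #J) (hJA : J ⊆ A) (hAU : A ⊆ U)
    (hAκ : #A ≤ κ) (hsplit : SplitBound L J) (hA : GoodSet L J A)
    (hsat : ∀ q : Set (Set N), #q ≤ κ → (∀ D ∈ q, U.Definable₁ L D) → (Filter.generate q).NeBot →
      ∃ c ∈ U, ∀ D ∈ q, c ∈ D)
    {q : Set (Set N)} (hq : ∀ D ∈ q, A.Definable₁ L D) (hqκ : #q < κ)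
    (hqne : (Filter.generate q).NeBot) :
    ∃ c ∈ U, (∀ D ∈ q, c ∈ D) ∧ GoodSet L J (insert c A) := by
  classical
  have h0 : ℵ₀ < κ := (le_max_right _ _).trans_lt hκ
  -- There are at most κ requirements, so κ stages meet them all. Each adds finitely many sets, so
  -- every stage has size < κ, as the pigeonhole in `GoodSet.exists_uniform` demands.
  let Req := Σ n : ℕ, (Fin n → A) ×
    {R : Set ((Fin n ⊕ Fin 1) ⊕ Fin 1 → N) // (∅ : Set N).Definable L R}
  let W := κ.ord.ToType
  have hReq : #Req ≤ #W := by
    rw [Cardinal.mk_ord_toType]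
    refine mk_sigma_nat_le h0.le fun n => ?_
    rw [Cardinal.mk_prod, Cardinal.lift_id, Cardinal.lift_id]
    refine Cardinal.mul_le_of_le h0.le (mk_fin_arrow_le h0.le hAκ n) ?_
    exact mk_definable_le hκ.le ((Fin n ⊕ Fin 1) ⊕ Fin 1)
  have : Nonempty Req := ⟨⟨0, Fin.elim0, Set.univ, Set.definable_univ⟩⟩
  obtain ⟨⟨g, hg⟩⟩ := Cardinal.le_def _ _ |>.1 hReq
  have hf := Function.invFun_surjective hg
  set f := Function.invFun g
  let Ok : Set (Set N) → Prop := fun s => (∀ D ∈ s, A.Definable₁ L D) ∧ (Filter.generate s).NeBot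
  let Spec : Set (Set N) → Req → Set (Set N) → Prop := fun s r Δ => Δ.Finite ∧
    (∀ D ∈ Δ, A.Definable₁ L D) ∧ (Filter.generate (s ∪ Δ)).NeBot ∧
      ∃ S : Set (Fin r.1 ⊕ Fin 1 → N), J.Definable L S ∧
        {x | Sum.elim (fun k => (r.2.1 k : N)) (fun _ => x) ∈ S} ∈ Filter.generate (s ∪ Δ) ∧
        ∃ F : Set N, F.Finite ∧
        ((∀ z ∈ S, ∀ j ∈ J \ F, Sum.elim z (fun _ => j) ∈ r.2.2.1) ∨
          ∀ z ∈ S, ∀ j ∈ J \ F, Sum.elim z (fun _ => j) ∉ r.2.2.1)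
  let Δ : Set (Set N) → W → Set (Set N) := fun s i =>
    if h : ∃ Δ, Spec s (f i) Δ then h.choose else ∅
  have hΔfin : ∀ s i, (Δ s i).Finite := by
    intro s i
    by_cases h : ∃ Δ, Spec s (f i) Δ
    · simp only [Δ, dif_pos h]
      exact h.choose_spec.1
    · simp only [Δ, dif_neg h, Set.finite_empty]
  obtain ⟨p, hp⟩ := exists_transfinite_union q Δ
  have hpκ : ∀ i, #(p i) < κ := mk_transfinite_union_lt h0 hp hqκ
    (fun i => mk_Iio_ord_toType_lt i) hΔfin
  have hspec : ∀ i, Ok (p i) → Spec (p i) (f i) (Δ (p i) i) := by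
    intro i hi
    have h : ∃ Δ, Spec (p i) (f i) Δ := by
      obtain ⟨Δ, h1, h2, h3, h4⟩ := hA.exists_decided h0 hJ hJA hsplit hi.1 (hpκ i) hi.2
        (fun k => ((f i).2.1 k).2) (f i).2.2.2
      exact ⟨Δ, h1, h2, h3, h4⟩
    simp only [Δ, dif_pos h]
    exact h.choose_spec
  have hOk : (∀ i, Ok (p i)) ∧ Ok (q ∪ ⋃ k, Δ (p k) k) := by
    refine transfinite_union_induction hp ?_ ?_ ⟨hq, hqne⟩ ?_
    · exact fun s t hst ht => ⟨fun D hD => ht.1 D (hst hD),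
        Filter.generate_neBot_iff.2 fun r hr => Filter.generate_neBot_iff.1 ht.2 r (hr.trans hst)⟩
    · intro s hs
      refine ⟨fun D hD => (hs {D} (by simpa using hD) (Set.finite_singleton D)).1 D rfl, ?_⟩
      exact Filter.generate_neBot_iff.2 fun r hr hrf =>
        Filter.generate_neBot_iff.1 (hs r hr hrf).2 r subset_rfl hrf
    · intro i hi
      have := hspec i hi
      exact ⟨fun D hD => hD.elim (hi.1 D) (this.2.1 D), this.2.2.1⟩
  -- The completed family can have size exactly κ, which is why `hsat` must cover size κ and not
  -- only smaller families.
  have hcard : #(q ∪ ⋃ k, Δ (p k) k : Set (Set N)) ≤ κ := by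
    refine (Cardinal.mk_union_le _ _).trans (Cardinal.add_le_of_le h0.le hqκ.le ?_)
    refine (Cardinal.mk_iUnion_le_sum_mk).trans ((Cardinal.sum_le_mk_mul_iSup _).trans ?_)
    refine Cardinal.mul_le_of_le h0.le (Cardinal.mk_ord_toType κ).le (ciSup_le' fun k => ?_)
    exact (Cardinal.mk_le_aleph0_iff.2 (hΔfin _ _).countable.to_subtype).trans h0.le
  obtain ⟨c, hcU, hc⟩ := hsat _ hcard (fun D hD => (hOk.2.1 D hD).mono hAU) hOk.2.2
  have hJne : J.Nonempty := by
    rw [← Set.nonempty_coe_sort, ← Cardinal.mk_ne_zero_iff]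
    exact (Cardinal.aleph0_pos.trans (h0.trans_le hJ)).ne'
  obtain ⟨a, ha⟩ := hJne
  refine ⟨c, hcU, fun D hD => hc D (Or.inl hD), goodSet_insert (hJA ha) fun n d hd R hR => ?_⟩
  obtain ⟨i, hi⟩ := hf ⟨n, fun k => ⟨d k, hd k⟩, R, hR⟩
  have := hspec i (hOk.1 i)
  rw [hi] at this
  obtain ⟨-, -, -, S, hS, hSm, F, hF, h⟩ := this
  refine ⟨S, hS, mem_of_mem_generate (fun D hD => hc D ?_) hSm, F, hF, h⟩
  exact transfinite_union_subset_total hp i hD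

end Extension

/-! ### Enumerations in length κ⁺ -/

section Cofinality

variable {κ : Cardinal.{w}}

/-- A set of size at most `κ⁺` is enumerated by `κ⁺` with every fiber unbounded. -/
theorem exists_cofinal_enumeration (hκ : ℵ₀ ≤ κ) {E : Type w} [Nonempty E]
    (hE : #E ≤ Order.succ κ) :
    ∃ e : (Order.succ κ).ord.ToType → E, ∀ x i, ∃ j, i ≤ j ∧ e j = x := by
  set W := (Order.succ κ).ord.ToType
  have hW : #W = Order.succ κ := Cardinal.mk_ord_toType _
  have h1 : #(E × W) ≤ #W := by
    rw [Cardinal.mk_prod, Cardinal.lift_id, Cardinal.lift_id, hW]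
    exact Cardinal.mul_le_of_le (hκ.trans (Order.le_succ κ)) hE le_rfl
  have : Nonempty W := by
    rw [← Cardinal.mk_ne_zero_iff, hW]
    exact (Cardinal.aleph0_pos.trans_le (hκ.trans (Order.le_succ κ))).ne'
  obtain ⟨⟨g, hg⟩⟩ := (Cardinal.le_def _ _).1 h1
  have hf := Function.invFun_surjective hg
  set f := Function.invFun g
  refine ⟨fun i => (f i).1, fun x i => ?_⟩
  by_contra! hcon
  have h2 : #W ≤ #(Set.Iio i) := by
    refine Cardinal.mk_le_of_surjective (f := fun j : Set.Iio i => (f j).2) fun y => ?_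
    obtain ⟨j, hj⟩ := hf (x, y)
    refine ⟨⟨j, ?_⟩, by simp [hj]⟩
    by_contra hij
    exact hcon j (not_lt.1 hij) (by simp [hj])
  exact (h2.trans_lt (mk_Iio_ord_toType_lt i)).ne hW

/-- This is regularity of κ⁺; it places the parameters of a small family in one stage. -/
theorem exists_upper_bound (hκ : ℵ₀ ≤ κ) {ι : Type w} (hι : #ι ≤ κ)
    (f : ι → (Order.succ κ).ord.ToType) : ∃ i, ∀ x, f x ≤ i := by
  by_contra! hcon
  have h : IsCofinal (Set.range f) := fun i => by
    obtain ⟨x, hx⟩ := hcon i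
    exact ⟨f x, ⟨x, rfl⟩, hx.le⟩
  have h1 := Order.cof_le h
  rw [Ordinal.cof_toType, (Cardinal.isRegular_succ hκ).cof_ord] at h1
  exact ((Order.lt_succ κ).trans_le (h1.trans Cardinal.mk_range_le)).not_ge hι

end Cofinality

/-! ### The good saturated set -/

section Construction

variable {L : FirstOrder.Language.{u, v}} {N : Type (max u v)} [L.Structure N] {J U : Set N}
  {κ : Cardinal.{max u v}}

theorem mk_definable₁_le (hκ : theoryCard L ≤ κ) (hU : #U ≤ κ) :
    #{D : Set N | U.Definable₁ L D} ≤ κ := by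
  have h0 : ℵ₀ ≤ κ := (le_max_right _ _).trans hκ
  have h : Function.Surjective fun φ : L.Formula (U ⊕ Fin 1) =>
      (⟨{x | φ.Realize (Sum.elim (fun a : U => (a : N)) fun _ => x)}, by
        refine Set.definable_iff_exists_formula_sum.2 ⟨φ, ?_⟩
        ext x
        have : x = fun _ => x 0 := funext fun i => by rw [Subsingleton.elim i 0]
        change φ.Realize _ ↔ φ.Realize _
        rw [← this]⟩ : {D : Set N | U.Definable₁ L D}) := by
    rintro ⟨D, hD⟩
    obtain ⟨φ, hφ⟩ := Set.definable_iff_exists_formula_sum.1 hD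
    refine ⟨φ, Subtype.ext ?_⟩
    ext x
    exact (Set.ext_iff.1 hφ fun _ => x).symm
  refine (Cardinal.mk_le_of_surjective h).trans (mk_formula_le_of_theoryCard_le hκ ?_)
  rw [Cardinal.mk_sum, Cardinal.lift_uzero, Cardinal.mk_fin]
  refine Cardinal.add_le_of_le h0 (by simpa using hU) ?_
  simpa using (Cardinal.natCast_lt_aleph0 (n := 1)).le.trans h0

/-- A good set over `J`, containing `J`, that realizes all its small definable families with the
finite intersection property. -/
theorem exists_saturated_goodSet (hκ : theoryCard L < κ) (h2κ : 2 ^ κ = Order.succ κ)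
    (hJ : #J = κ) (hJU : J ⊆ U) (hU : #U ≤ Order.succ κ) (hsplit : SplitBound L J)
    (hgood : GoodSet L J J)
    (hsat : ∀ q : Set (Set N), #q ≤ κ → (∀ D ∈ q, U.Definable₁ L D) → (Filter.generate q).NeBot →
      ∃ c ∈ U, ∀ D ∈ q, c ∈ D) :
    ∃ M : Set N, J ⊆ M ∧ GoodSet L J M ∧
      ∀ q : Set (Set N), #q < κ → (∀ D ∈ q, M.Definable₁ L D) → (Filter.generate q).NeBot →
        ∃ c ∈ M, ∀ D ∈ q, c ∈ D := by
  classical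
  have h0 : ℵ₀ < κ := (le_max_right _ _).trans_lt hκ
  have h0' : ℵ₀ < Order.succ κ := h0.trans (Order.lt_succ κ)
  let E := {q : Set (Set N) // q ⊆ {D | U.Definable₁ L D} ∧ #q ≤ κ}
  -- The cardinal arithmetic is (κ⁺)^κ = (2^κ)^κ = 2^κ = κ⁺.
  have hE : #E ≤ Order.succ κ := by
    refine (Cardinal.mk_bounded_subset_le _ κ).trans ?_
    refine (Cardinal.power_le_power_right (max_le
      (mk_definable₁_le (hκ.le.trans (Order.le_succ κ)) hU) h0'.le)).trans ?_
    rw [← h2κ, ← Cardinal.power_mul, Cardinal.mul_eq_self h0.le]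
  have : Nonempty E := ⟨⟨∅, Set.empty_subset _, by simp⟩⟩
  obtain ⟨e, he⟩ := exists_cofinal_enumeration h0.le hE
  have := Cardinal.noMaxOrder h0'.le
  let Spec : Set N → E → N → Prop := fun s x c =>
    c ∈ U ∧ (∀ D ∈ x.1, c ∈ D) ∧ GoodSet L J (insert c s)
  -- The parameters of `e i` range over all of `U` and may be absent from stage `i`. If no suitable
  -- point exists, nothing is added; the family recurs at later stages.
  let Δ : Set N → (Order.succ κ).ord.ToType → Set N := fun s i =>
    if h : ∃ c, Spec s (e i) c then {h.choose} else ∅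
  have hΔ : ∀ s i, Δ s i = ∅ ∨ ∃ c, Δ s i = {c} ∧ Spec s (e i) c := by
    intro s i
    by_cases h : ∃ c, Spec s (e i) c
    · exact Or.inr ⟨h.choose, by simp only [Δ, dif_pos h], h.choose_spec⟩
    · exact Or.inl (by simp only [Δ, dif_neg h])
  obtain ⟨p, hp⟩ := exists_transfinite_union J Δ
  have hpκ : ∀ i, #(p i) ≤ κ := fun i => Order.lt_succ_iff.1 <|
    mk_transfinite_union_lt h0' hp (hJ.trans_lt (Order.lt_succ κ)) mk_Iio_ord_toType_lt
      (fun s i => by rcases hΔ s i with h | ⟨c, h, -⟩ <;> simp [h]) i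
  have hP : (∀ i, p i ⊆ U ∧ GoodSet L J (p i)) ∧
      (J ∪ ⋃ k, Δ (p k) k ⊆ U ∧ GoodSet L J (J ∪ ⋃ k, Δ (p k) k)) := by
    refine transfinite_union_induction (P := fun s => s ⊆ U ∧ GoodSet L J s) hp
      (fun s t hst ht => ⟨hst.trans ht.1, ht.2.mono hst⟩)
      (fun s hs => ⟨fun x hx => (hs {x} (by simpa using hx) (Set.finite_singleton x)).1 rfl,
        GoodSet.of_finite fun t ht htf => (hs t ht htf).2⟩) ⟨hJU, hgood⟩ fun i hi => ?_
    rcases hΔ (p i) i with h | ⟨c, h, hcU, -, hc⟩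
    · rwa [h, Set.union_empty]
    · rw [h, Set.union_singleton]
      exact ⟨Set.insert_subset hcU hi.1, hc⟩
  refine ⟨_, Set.subset_union_left, hP.2.2, fun q hqκ hq hqne => ?_⟩
  have hidx : ∀ D : q, ∃ i, (p i).Definable₁ L (D : Set N) := by
    intro D
    obtain ⟨A, hA, hAD⟩ := Set.definable_iff_finitely_definable.1 (hq D D.2)
    have hA' : (A : Set N) ⊆ J ∪ ⋃ k ∈ Set.univ, Δ (p k) k := by simpa using hA
    rcases finite_subset_transfinite_union hp Set.univ A.finite_toSet hA' with h | ⟨k, -, h⟩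
    · have hne : Nonempty (Order.succ κ).ord.ToType := by
        rw [← Cardinal.mk_ne_zero_iff, Cardinal.mk_ord_toType]
        exact (Cardinal.aleph0_pos.trans h0').ne'
      obtain ⟨i⟩ := hne
      exact ⟨i, hAD.mono (h.trans (by rw [hp i]; exact Set.subset_union_left))⟩
    · obtain ⟨i, hi⟩ := exists_gt k
      exact ⟨i, hAD.mono (h.trans (transfinite_union_subset hp hi))⟩
  choose idx hidx using hidx
  obtain ⟨i₀, hi₀⟩ := exists_upper_bound h0.le hqκ.le idx
  obtain ⟨i, hi, hei⟩ := he ⟨q, fun D hD => (hq D hD).mono hP.2.1, hqκ.le⟩ i₀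
  have hqi : ∀ D ∈ q, (p i).Definable₁ L D := fun D hD =>
    (hidx ⟨D, hD⟩).mono (transfinite_union_mono hp ((hi₀ ⟨D, hD⟩).trans hi))
  have hJp : J ⊆ p i := by rw [hp i]; exact Set.subset_union_left
  obtain ⟨c, hcU, hcq, hc⟩ := (hP.1 i).2.exists_insert hκ hJ.ge hJp (hP.1 i).1 (hpκ i) hsplit hsat
    hqi hqκ hqne
  have hex : ∃ c, Spec (p i) (e i) c := ⟨c, hcU, by rwa [hei], hc⟩
  refine ⟨hex.choose, Or.inr (Set.mem_iUnion.2 ⟨i, ?_⟩), ?_⟩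
  · simp only [Δ, dif_pos hex, Set.mem_singleton_iff]
  · exact fun D hD => hex.choose_spec.2.1 D (by rwa [hei])

end Construction

/-! ### From good sets to exact saturation -/

section ExactSaturation

variable {L : FirstOrder.Language.{u, v}} {N : Type (max u v)} [L.Structure N]
  {κ : Cardinal.{max u v}}

/-- The trace on an elementary substructure of a definable set with parameters in it. -/
theorem definable_trace (S : L.ElementarySubstructure N) {J : Set N} (hJS : J ⊆ S)
    {β : Type} {D : Set (β → N)} (hD : J.Definable L D) :
    ((Subtype.val : S → N) ⁻¹' J).Definable L {w : β → S | (fun i => (w i : N)) ∈ D} := by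
  obtain ⟨n, d, E, hd, hE, rfl⟩ := hD.exists_fiber
  obtain ⟨φ, rfl⟩ := Set.empty_definable_iff.1 hE
  have := Set.Definable.fiber (L := L) (M := S) (A := (Subtype.val : S → N) ⁻¹' J)
    (D := {v : Fin n ⊕ β → S | φ.Realize v})
    ((Set.empty_definable_iff.2 ⟨φ, rfl⟩).mono (Set.empty_subset _))
    (fun i => (⟨d i, hJS (hd i)⟩ : S)) hd
  refine (congrArg _ ?_).mp this
  ext w
  simp only [Set.mem_ofPred_eq]
  rw [← S.subtype.map_formula]
  refine iff_of_eq (congrArg _ ?_)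
  ext (i | i) <;> rfl

theorem isSaturated_of_realizes (hκ : theoryCard L < κ) (S : L.ElementarySubstructure N)
    (hS : ∀ q : Set (Set N), #q < κ → (∀ D ∈ q, (S : Set N).Definable₁ L D) →
      (Filter.generate q).NeBot → ∃ c ∈ (S : Set N), ∀ D ∈ q, c ∈ D) :
    IsSaturated L S κ := by
  have h0 : ℵ₀ < κ := (le_max_right _ _).trans_lt hκ
  intro A hA N' _ f c
  let D : L.Formula (A ⊕ Fin 1) → Set N := fun φ =>
    {x | φ.Realize (Sum.elim (fun a : A => ((a : S) : N)) fun _ => x)}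
  let q : Set (Set N) := D '' tp L (fun a : A => f (a : S)) c
  have hqκ : #q < κ := by
    refine Cardinal.mk_image_le.trans_lt ((Cardinal.mk_set_le _).trans_lt
      ((mk_formula_le L _).trans_lt (max_lt h0 ?_)))
    rw [Cardinal.lift_id, Cardinal.lift_id]
    refine Cardinal.add_lt_of_lt h0.le ?_ ((le_max_left _ _).trans_lt hκ)
    rw [Cardinal.mk_sum, Cardinal.lift_uzero, Cardinal.mk_fin]
    exact Cardinal.add_lt_of_lt h0.le (by simpa using hA)
      (by simpa using (Cardinal.natCast_lt_aleph0 (n := 1)).trans h0)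
  have hqdef : ∀ E ∈ q, (S : Set N).Definable₁ L E := by
    rintro _ ⟨φ, -, rfl⟩
    have := Set.Definable.fiber (L := L) (A := (S : Set N)) (D := {v | φ.Realize v})
      ((Set.empty_definable_iff.2 ⟨φ, rfl⟩).mono (Set.empty_subset _))
      (fun a : A => ((a : S) : N)) (fun a => (a : S).2)
    refine (congrArg ((S : Set N).Definable L) ?_).mp this
    ext x
    have hx : x = fun _ => x 0 := funext fun i => by rw [Subsingleton.elim i 0]
    change φ.Realize _ ↔ φ.Realize _
    rw [← hx]
  have hSD : ∀ (φ : L.Formula (A ⊕ Fin 1)) (x : Fin 1 → S),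
      ((x 0 : S) : N) ∈ D φ ↔ φ ∈ tp L (fun a : A => (a : S)) x := by
    intro φ x
    change φ.Realize _ ↔ φ.Realize _
    rw [← S.subtype.map_formula]
    refine iff_of_eq (congrArg _ ?_)
    ext (i | i)
    · rfl
    · rw [Subsingleton.elim i 0]; rfl
  have hqne : (Filter.generate q).NeBot := by
    rw [Filter.generate_neBot_iff]
    intro t ht htf
    have : ∃ χ ∈ tp L (fun a : A => f (a : S)) c, D χ ⊆ ⋂₀ t := by
      induction t, htf using Set.Finite.induction_on with
      | empty => exact ⟨⊤, by simp [tp], by simp⟩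
      | @insert E t _ _ ih =>
        obtain ⟨χ, hχ, hχt⟩ := ih ((Set.subset_insert _ _).trans ht)
        obtain ⟨φ, hφ, rfl⟩ := ht (Set.mem_insert _ _)
        refine ⟨φ ⊓ χ, FirstOrder.Language.Formula.realize_inf.2 ⟨hφ, hχ⟩, ?_⟩
        rw [Set.sInter_insert]
        intro x hx
        have hx := FirstOrder.Language.Formula.realize_inf.1 hx
        exact ⟨hx.1, hχt hx.2⟩
    obtain ⟨χ, hχ, hχt⟩ := this
    have h1 : (χ.iExs (Fin 1)).Realize (f ∘ fun a : A => (a : S)) := by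
      rw [FirstOrder.Language.Formula.realize_iExs]
      exact ⟨c, hχ⟩
    rw [f.map_formula, FirstOrder.Language.Formula.realize_iExs] at h1
    obtain ⟨x, hx⟩ := h1
    exact ⟨x 0, hχt ((hSD χ x).2 hx)⟩
  obtain ⟨d, hdS, hd⟩ := hS q hqκ hqdef hqne
  refine ⟨fun _ => ⟨d, hdS⟩, ?_⟩
  have hsub : ∀ φ ∈ tp L (fun a : A => f (a : S)) c,
      φ ∈ tp L (fun a : A => (a : S)) fun _ : Fin 1 => (⟨d, hdS⟩ : S) :=
    fun φ hφ => (hSD φ _).1 (hd _ ⟨φ, hφ, rfl⟩)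
  refine Set.Subset.antisymm (fun φ hφ => ?_) hsub
  by_contra hcon
  have h1 : ∼φ ∈ tp L (fun a : A => f (a : S)) c :=
    FirstOrder.Language.Formula.realize_not.2 hcon
  exact FirstOrder.Language.Formula.realize_not.1 (hsub _ h1) hφ

/-- The type over `J` of any nonprincipal ultrafilter on `J` is omitted: goodness of `d` for
equality yields a `J`-definable set that contains `d` and misses all but finitely many points of
`J`. -/
theorem not_isSaturated_of_goodSet [Nonempty N] (h0 : ℵ₀ ≤ κ) (S : L.ElementarySubstructure N)
    {J : Set N} (hJ : #J = κ) (hJS : J ⊆ S) (hgood : GoodSet L J S) :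
    ¬ IsSaturated L S (Order.succ κ) := by
  intro hsat
  have hJinf : J.Infinite := by
    rw [← Set.infinite_coe_iff, Cardinal.infinite_iff, hJ]
    exact h0
  let J' : Set S := Subtype.val ⁻¹' J
  have himg : Subtype.val '' J' = J := by
    ext x
    exact ⟨by rintro ⟨s, hs, rfl⟩; exact hs, fun hx => ⟨⟨x, hJS hx⟩, hx, rfl⟩⟩
  have hJ'inf : J'.Infinite := Set.Infinite.of_image Subtype.val (by rwa [himg])
  have hJ' : #J' < Order.succ κ := by
    rw [Order.lt_succ_iff, ← hJ, ← himg, Cardinal.mk_image_eq Subtype.val_injective]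
  have := hJ'inf.cofinite_inf_principal_neBot
  obtain ⟨d, hd⟩ := hsat.exists_mem hJ' (Ultrafilter.of (Filter.cofinite ⊓ Filter.principal J'))
  obtain ⟨D, hD, hdD, F, hF, h⟩ := hgood 1 (fun _ => (d : N)) (fun _ => d.2)
    {v | v (Sum.inl 0) = v (Sum.inr 0)}
    (Set.empty_definable_iff.2 ⟨(FirstOrder.Language.Term.var (Sum.inl 0)).equal
      (FirstOrder.Language.Term.var (Sum.inr 0)), by ext; simp⟩)
  rcases h with h | h
  · obtain ⟨j, hj, hjd⟩ := ((hJinf.sdiff hF).sdiff (Set.finite_singleton (d : N))).nonempty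
    exact hjd (h _ hdD j hj).symm
  · refine hd {s : S | (fun _ : Fin 1 => (s : N)) ∉ D} ?_ ?_ hdD
    · have := definable_trace S hJS hD.compl
      refine (congrArg (J'.Definable L) ?_).mp this
      ext x
      have hx : (fun i => ((x i : S) : N)) = fun _ => ((x 0 : S) : N) :=
        funext fun i => by rw [Subsingleton.elim i 0]
      simp only [Set.mem_ofPred_eq, hx, Set.mem_compl_iff]
    · refine Ultrafilter.of_le _ ?_
      rw [Filter.mem_inf_principal]
      have hF' : ((Subtype.val : S → N) ⁻¹' F).Finite := hF.preimage Subtype.val_injective.injOn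
      filter_upwards [hF'.compl_mem_cofinite] with s hsF hsJ hsD
      exact h _ hsD s ⟨hsJ, hsF⟩ rfl

/-- A model with a good set over an indiscernible set `J` yields an exactly saturated model. -/
theorem hasExactlySaturatedModel_of_splitBound {T : L.Theory} [N ⊨ T] [Nonempty N] {J U : Set N}
    (hκ : theoryCard L < κ) (h2κ : 2 ^ κ = Order.succ κ)
    (hJ : #J = κ) (hJU : J ⊆ U) (hU : #U ≤ Order.succ κ) (hsplit : SplitBound L J)
    (hgood : GoodSet L J J)
    (hsat : ∀ q : Set (Set N), #q ≤ κ → (∀ D ∈ q, U.Definable₁ L D) → (Filter.generate q).NeBot →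
      ∃ c ∈ U, ∀ D ∈ q, c ∈ D) : HasExactlySaturatedModel T κ := by
  have h0 : ℵ₀ < κ := (le_max_right _ _).trans_lt hκ
  obtain ⟨M, hJM, hM, hMsat⟩ := exists_saturated_goodSet hκ h2κ hJ hJU hU hsplit hgood hsat
  -- This is the Tarski–Vaught test; a nonempty definable set is a family with one member.
  have hmeets : L.MeetsDefinable M := by
    intro D hDne hD
    obtain ⟨c, hcM, hc⟩ := hMsat {D} (by simpa using (Cardinal.natCast_lt_aleph0 (n := 1)).trans h0)
      (by simpa using hD) (Filter.generate_neBot_iff.2 fun t ht _ => hDne.mono fun x hx E hE => by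
        rwa [show E = D from ht hE])
    exact ⟨c, hc D rfl, hcM⟩
  let S := hmeets.toElementarySubstructure
  have hSM : (S : Set N) = M := hmeets.closure_eq_self
  rw [← hSM] at hJM hM hMsat
  have : S ⊨ T := (FirstOrder.Language.ElementarySubstructure.theory_model_iff S T).2 inferInstance
  exact ⟨FirstOrder.Language.Theory.ModelType.of T S, isSaturated_of_realizes hκ S hMsat,
    not_isSaturated_of_goodSet h0.le S hJ hJM hM⟩

end ExactSaturation

/-! ### A Henkin model whose variables form a W-type -/

section Henkin

variable {L : FirstOrder.Language.{u, v}}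

/-- A Henkin construction: the formulas `fam t` describe the variable `t` in terms of smaller
variables, and they are satisfied as soon as they are finitely satisfiable. -/
theorem exists_henkin_model {V : Type (max u v)} [LinearOrder V] [WellFoundedLT V] {T : L.Theory}
    {Γ : Set (L.Formula V)} (hΓ : FinSat T Γ) (fam : V → Set (L.Formula V)) (B : Set V)
    (hΓB : ∀ γ ∈ Γ, ∀ (M : Type (max u v)) [L.Structure M] (x y : V → M), (∀ t ∈ B, x t = y t) →
      γ.Realize x → γ.Realize y)
    (hfam : ∀ t, ∀ γ ∈ fam t, ∀ (M : Type (max u v)) [L.Structure M] (x y : V → M),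
      (∀ s ≤ t, x s = y s) → γ.Realize x → γ.Realize y) :
    ∃ (N : FirstOrder.Language.Theory.ModelType.{u, v, max u v} T) (x : V → N),
      (∀ γ ∈ Γ, γ.Realize x) ∧ ∀ t ∉ B, (∀ s ⊆ fam t, s.Finite →
        ∃ c : N, ∀ γ ∈ s, γ.Realize (Function.update x t c)) → ∀ γ ∈ fam t, γ.Realize x := by
  classical
  let Δ : Set (L.Formula V) → V → Set (L.Formula V) := fun q t =>
    if FinSat T (q ∪ fam t) then fam t else ∅
  have hΔ : ∀ q t, Δ q t ⊆ fam t := by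
    intro q t
    by_cases h : FinSat T (q ∪ fam t)
    · simp only [Δ, if_pos h, subset_rfl]
    · simp only [Δ, if_neg h, Set.empty_subset]
  obtain ⟨q, hq⟩ := exists_transfinite_union Γ Δ
  have hfin := transfinite_union_induction (P := FinSat T) hq (fun s t hst ht => ht.mono hst)
    (fun s hs => FinSat.of_finite hs) hΓ fun t ht => by
      by_cases h : FinSat T (q t ∪ fam t)
      · simpa only [Δ, if_pos h] using h
      · simpa only [Δ, if_neg h, Set.union_empty] using ht
  obtain ⟨N, x, hx⟩ := hfin.2.exists_realize
  refine ⟨N, x, fun γ hγ => hx γ (Or.inl hγ), fun t htB ht => ?_⟩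
  -- All conditions imposed before stage `t` concern variables in `B` or below `t`, so changing the
  -- value of `t` alone preserves them. Finite satisfiability in the final model thus shows that
  -- `fam t` was added.
  have h : FinSat T (q t ∪ fam t) := by
    intro s hs hsf
    obtain ⟨c, hc⟩ := ht (s ∩ fam t) Set.inter_subset_right (hsf.inter_of_left _)
    refine ⟨N, Function.update x t c, fun γ hγ => ?_⟩
    by_cases hγt : γ ∈ fam t
    · exact hc γ ⟨hγ, hγt⟩
    · have hγq := (hs hγ).resolve_right hγt
      have hγx := hx γ (transfinite_union_subset_total hq t (Or.inl hγq))
      rw [hq t] at hγq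
      rcases hγq with h | h
      · refine hΓB γ h N x _ (fun s hs => ?_) hγx
        have hst : s ≠ t := fun h => htB (h ▸ hs)
        rw [Function.update_of_ne hst]
      · simp only [Set.mem_iUnion] at h
        obtain ⟨k, hk, h⟩ := h
        refine hfam k γ (hΔ _ _ h) N x _ (fun s hs => ?_) hγx
        rw [Function.update_of_ne (hs.trans_lt hk).ne]
  intro γ hγ
  refine hx γ (Or.inr (Set.mem_iUnion.2 ⟨t, ?_⟩))
  simpa only [Δ, if_pos h] using hγ

variable (L) in
/-- The arities of the variables of the Henkin construction. -/
def HenkinArity (K : Type (max u v)) :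
    K ⊕ (K → Σ n : ℕ, L.Formula (Fin n ⊕ Fin 1)) → Type (max u v) :=
  Sum.elim (fun _ => PEmpty) fun f => Σ k, Fin (f k).1

variable (L) in
/-- The variables of the Henkin construction: those indexed by `K`, and one for each family indexed
by `K` of formulas in one variable whose parameters are previous variables. -/
abbrev HenkinVar (K : Type (max u v)) : Type (max u v) := WType (HenkinArity L K)

namespace HenkinVar

variable {K : Type (max u v)}

/-- The variable with index `k`. -/
def base (k : K) : HenkinVar L K := WType.mk (Sum.inl k) PEmpty.elim

/-- The variable for the family `f` of formulas with parameters `g`. -/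
def new (f : K → Σ n : ℕ, L.Formula (Fin n ⊕ Fin 1)) (g : (Σ k, Fin (f k).1) → HenkinVar L K) :
    HenkinVar L K := WType.mk (Sum.inr f) g

theorem base_injective : Function.Injective (base : K → HenkinVar L K) := by
  intro k l h
  simpa using (WType.mk.inj h).1

/-- The formulas that describe a variable. -/
def fam : HenkinVar L K → Set (L.Formula (HenkinVar L K))
  | ⟨Sum.inl _, _⟩ => ∅
  | ⟨Sum.inr f, g⟩ => Set.range fun k => (f k).2.relabel
      (Sum.elim (fun i => g ⟨k, i⟩) fun _ => WType.mk (Sum.inr f) g)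

/-- The immediate-subtree relation of a W-type is well founded; a well-order extending it puts each
variable after its parameters. -/
theorem exists_linearOrder : ∃ (_ : LinearOrder (HenkinVar L K)) (_ : WellFoundedLT (HenkinVar L K)),
    ∀ (f : K → Σ n : ℕ, L.Formula (Fin n ⊕ Fin 1)) (g : (Σ k, Fin (f k).1) → HenkinVar L K) (i),
      g i < new f g := by
  classical
  let r : HenkinVar L K → HenkinVar L K → Prop := fun s t => ∃ a f b, t = WType.mk a f ∧ s = f b
  have hr : WellFounded r := by
    refine ⟨fun t => ?_⟩
    induction t with
    | mk a f ih =>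
      refine ⟨_, ?_⟩
      rintro _ ⟨a', f', b, h, rfl⟩
      cases h
      exact ih b
  have : IsWellFounded _ r := ⟨hr⟩
  obtain ⟨s, hrs, hs⟩ := IsWellFounded.exists_well_order_ge r
  refine ⟨linearOrderOfSTO s, ⟨hs.wf⟩, fun f g i => hrs _ _ ⟨Sum.inr f, g, i, rfl, rfl⟩⟩

/-- There are at most κ⁺ labels, each of arity at most κ, and (κ⁺)^κ = κ⁺, so κ⁺ is closed under the
formation of trees. -/
theorem mk_le {κ : Cardinal.{max u v}} (hκ : theoryCard L ≤ κ) (h2κ : 2 ^ κ = Order.succ κ)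
    (hK : #K = κ) : #(HenkinVar L K) ≤ Order.succ κ := by
  have h0 : ℵ₀ ≤ κ := (le_max_right _ _).trans hκ
  have h0' : ℵ₀ ≤ Order.succ κ := h0.trans (Order.le_succ κ)
  have hpow : Order.succ κ ^ κ = Order.succ κ := by
    rw [← h2κ, ← Cardinal.power_mul, Cardinal.mul_eq_self h0]
  refine WType.cardinalMk_le_of_le ((Cardinal.sum_le_mk_mul_iSup _).trans
    (Cardinal.mul_le_of_le h0' ?_ (ciSup_le' fun a => ?_)))
  · rw [Cardinal.mk_sum, Cardinal.lift_id, Cardinal.lift_id]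
    refine Cardinal.add_le_of_le h0' (hK.le.trans (Order.le_succ κ)) ?_
    rw [← Cardinal.power_def, hK]
    refine (Cardinal.power_le_power_right ?_).trans hpow.le
    exact (mk_sigma_nat_le h0 fun n => mk_formula_finite_le hκ _).trans (Order.le_succ κ)
  · refine (Cardinal.power_le_power_left (Cardinal.aleph0_pos.trans_le h0').ne' ?_).trans hpow.le
    rcases a with k | f
    · simp [HenkinArity]
    · change #(Σ k, Fin (f k).1) ≤ κ
      refine (Cardinal.mk_le_of_injective (β := K × ULift.{max u v} ℕ)
        (f := fun x => (x.1, ⟨x.2⟩)) ?_).trans ?_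
      · rintro ⟨k, i⟩ ⟨l, j⟩ h
        obtain ⟨rfl, h⟩ := Prod.ext_iff.1 h
        exact Sigma.ext rfl (heq_of_eq (Fin.ext (ULift.up_injective h)))
      · rw [Cardinal.mk_prod, Cardinal.lift_id, Cardinal.lift_id, hK]
        exact Cardinal.mul_le_of_le h0 le_rfl (by simpa using h0)

end HenkinVar

end Henkin

/-! ### Stretching the indiscernible set to size κ -/

section EM

variable {L : FirstOrder.Language.{u, v}}

/-- Tuples with the same equality pattern of members of an indiscernible set satisfy the same
formulas. -/
theorem IsIndiscernibleSet.realize_of_realize {M : Type w} [L.Structure M] {I : Set (Fin 1 → M)}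
    (hI : IsIndiscernibleSet L I) {α : Type z} [Finite α] (φ : L.Formula α) {x y : α → M}
    (hx : ∀ i, (fun _ => x i) ∈ I) (hy : ∀ i, (fun _ => y i) ∈ I)
    (hxy : ∀ i j, x i = x j ↔ y i = y j) (h : φ.Realize x) : φ.Realize y := by
  obtain ⟨n, ⟨ε⟩⟩ := Finite.exists_equiv_fin (Set.range x)
  let g : α → Fin n := fun i => ε ⟨x i, i, rfl⟩
  have hsec : ∀ l : Fin n, ∃ i, x i = ε.symm l := fun l => (ε.symm l).2
  choose s hs using hsec
  let a : Fin n ↪ I := ⟨fun l => ⟨fun _ => x (s l), hx _⟩, fun l l' hll => by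
    have h1 : x (s l) = x (s l') := congrFun (congrArg Subtype.val hll) 0
    rw [hs, hs] at h1
    exact ε.symm.injective (Subtype.ext h1)⟩
  let b : Fin n ↪ I := ⟨fun l => ⟨fun _ => y (s l), hy _⟩, fun l l' hll => by
    have h1 : y (s l) = y (s l') := congrFun (congrArg Subtype.val hll) 0
    rw [← hxy, hs, hs] at h1
    exact ε.symm.injective (Subtype.ext h1)⟩
  have hg : ∀ i, x (s (g i)) = x i := fun i => by rw [hs, Equiv.symm_apply_apply]
  have key := hI n a b (φ.relabel fun i => (g i, 0))
  rw [FirstOrder.Language.Formula.realize_relabel,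
    FirstOrder.Language.Formula.realize_relabel] at key
  have h1 : (fun p : Fin n × Fin 1 => (a p.1 : Fin 1 → M) p.2) ∘ (fun i => (g i, 0)) = x :=
    funext hg
  have h2 : (fun p : Fin n × Fin 1 => (b p.1 : Fin 1 → M) p.2) ∘ (fun i => (g i, 0)) = y :=
    funext fun i => (hxy _ _).1 (hg i)
  rw [h1, h2] at key
  exact key.1 h

/-- The formulas with variables in `K` that hold in `M` whenever the variables are interpreted by
pairwise distinct members of `I`. -/
def emFormulas (L : FirstOrder.Language.{u, v}) {M : Type w} [L.Structure M] (I : Set (Fin 1 → M))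
    (K : Type z) : Set (L.Formula K) :=
  {γ | ∃ F : Set K, F.Finite ∧ ∀ e : K → M, (∀ k, (fun _ => e k) ∈ I) → Set.InjOn e F →
    γ.Realize e}

theorem exists_injOn_of_infinite {M : Type w} {I : Set (Fin 1 → M)} (hI : I.Infinite) {K : Type z}
    {F : Set K} (hF : F.Finite) : ∃ e : K → M, (∀ k, (fun _ => e k) ∈ I) ∧ Set.InjOn e F := by
  obtain ⟨f, hf⟩ := Set.countable_iff_exists_injOn.1 hF.countable
  let g := hI.natEmbedding
  refine ⟨fun k => (g (f k) : Fin 1 → M) 0, fun k => ?_, fun k hk l hl hkl => hf hk hl ?_⟩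
  · convert (g (f k)).2 using 1
    ext i
    rw [Subsingleton.elim i 0]
  · refine g.injective (Subtype.ext (funext fun i => ?_))
    rw [Subsingleton.elim i 0]
    exact hkl

theorem finSat_emFormulas {T : L.Theory}
    (C : FirstOrder.Language.Theory.ModelType.{u, v, max u v} T) {I : Set (Fin 1 → C)}
    (hI : I.Infinite) {K V : Type z} {b : K → V} (hb : Function.Injective b) :
    FinSat T ((fun γ : L.Formula K => γ.relabel b) '' emFormulas L I K) := by
  intro s hs hsf
  obtain ⟨t, ht, htf, rfl⟩ := hsf.exists_subset_finite_image_eq hs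
  choose F hF hFe using fun γ : t => ht γ.2
  have := htf.to_subtype
  obtain ⟨e, heI, he⟩ := exists_injOn_of_infinite hI (Set.finite_iUnion hF)
  have a : C := Classical.choice inferInstance
  refine ⟨C, Function.extend b e fun _ => a, ?_⟩
  rintro _ ⟨γ, hγ, rfl⟩
  rw [FirstOrder.Language.Formula.realize_relabel, Function.extend_comp hb]
  exact hFe ⟨γ, hγ⟩ e heI (he.mono (Set.subset_iUnion F ⟨γ, hγ⟩))

variable {M : Type w} [L.Structure M] {I : Set (Fin 1 → M)} {N : Type w} [L.Structure N]
  {K : Type z} {x : K → N}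

theorem injective_of_realize_emFormulas (hx : ∀ γ ∈ emFormulas L I K, γ.Realize x) :
    Function.Injective x := by
  intro k l hkl
  by_contra hne
  have := hx (∼((FirstOrder.Language.Term.var k).equal (FirstOrder.Language.Term.var l)))
    ⟨{k, l}, by simp, fun e _ he => by
      simpa using fun h => hne (he (by simp) (by simp) h)⟩
  simp [hkl] at this

theorem goodSet_of_realize_emFormulas (hI : IsIndiscernibleSet L I)
    (hx : ∀ γ ∈ emFormulas L I K, γ.Realize x) :
    GoodSet L (Set.range x) (Set.range x) := by
  refine goodSet_self fun n d j j' hd hj hj' R hR => ?_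
  obtain ⟨φ, rfl⟩ := Set.empty_definable_iff.1 hR
  choose k hk using hd
  obtain rfl : x ∘ k = d := funext hk
  obtain ⟨⟨a, rfl⟩, ha⟩ := hj
  obtain ⟨⟨b, rfl⟩, hb⟩ := hj'
  have ha' : ∀ i, k i ≠ a := fun i h => ha ⟨i, congrArg x h⟩
  have hb' : ∀ i, k i ≠ b := fun i h => hb ⟨i, congrArg x h⟩
  -- The implication holds on distinct members of `I` because `(k, a)` and `(k, b)` have the same
  -- equality pattern.
  have := hx ((φ.relabel (Sum.elim k fun _ => a)).imp (φ.relabel (Sum.elim k fun _ => b)))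
    ⟨Set.range k ∪ {a, b}, (Set.finite_range k).union (by simp), fun e heI he => by
      rw [FirstOrder.Language.Formula.realize_imp, FirstOrder.Language.Formula.realize_relabel,
        FirstOrder.Language.Formula.realize_relabel]
      have hka : ∀ i, e (k i) ≠ e a := fun i h =>
        ha' i (he (Or.inl ⟨i, rfl⟩) (Or.inr (by simp)) h)
      have hkb : ∀ i, e (k i) ≠ e b := fun i h =>
        hb' i (he (Or.inl ⟨i, rfl⟩) (Or.inr (by simp)) h)
      refine hI.realize_of_realize φ (fun i => heI _) (fun i => heI _) ?_
      rintro (i | i) (j | j)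
      · exact Iff.rfl
      · simp [hka, hkb]
      · simp [(hka _).symm, (hkb _).symm]
      · simp⟩
  rw [FirstOrder.Language.Formula.realize_imp, FirstOrder.Language.Formula.realize_relabel,
    FirstOrder.Language.Formula.realize_relabel, Sum.comp_elim, Sum.comp_elim] at this
  exact this

/-- That no parameter splits given points `p`, `q` is a formula in these finitely many points, hence
it transfers from `I`. -/
theorem splitBound_of_realize_emFormulas
    (hI : ∀ (m : ℕ) (φ : L.Formula (Fin 1 ⊕ Fin m)), ∃ n : ℕ, ∀ b : Fin m → M,
      ¬ ((∃ p : Fin n ↪ I, ∀ k, φ.Realize (Sum.elim (p k : Fin 1 → M) b)) ∧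
        ∃ q : Fin n ↪ I, ∀ k, ¬ φ.Realize (Sum.elim (q k : Fin 1 → M) b)))
    (hx : ∀ γ ∈ emFormulas L I K, γ.Realize x) : SplitBound L (Set.range x) := by
  intro α _ R hR
  obtain ⟨φ, rfl⟩ := Set.empty_definable_iff.1 hR
  obtain ⟨m, ⟨ε⟩⟩ := Finite.exists_equiv_fin α
  let φ' : L.Formula (Fin 1 ⊕ Fin m) := φ.relabel (Sum.elim (fun a => Sum.inr (ε a)) Sum.inl)
  obtain ⟨n, hn⟩ := hI m φ'
  refine ⟨n, fun z P Q hP hQ hPR hQR => ?_⟩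
  by_contra! hcard
  have hemb : ∀ P : Finset N, (P : Set N) ⊆ Set.range x → n ≤ P.card →
      ∃ p : Fin n ↪ K, ∀ i, x (p i) ∈ P := by
    intro P hP hcard
    let p₀ : Fin n ↪ P := (Fin.castLEEmb hcard).trans P.equivFin.symm.toEmbedding
    choose f hf using fun i => hP (p₀ i).2
    refine ⟨⟨f, fun i j hij => p₀.injective (Subtype.ext ?_)⟩, fun i => ?_⟩
    · rw [← hf, ← hf, hij]
    · exact (hf i).symm ▸ (p₀ i).2
  obtain ⟨p, hp⟩ := hemb P hP hcard.1
  obtain ⟨q, hq⟩ := hemb Q hQ hcard.2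
  let ψ : K → L.Formula (K ⊕ Fin m) := fun k => φ'.relabel (Sum.map (fun _ => k) id)
  have hψ : ∀ (M' : Type w) [L.Structure M'] (e : K → M') (b : Fin m → M') (k : K),
      (ψ k).Realize (Sum.elim e b) ↔ φ'.Realize (Sum.elim (fun _ => e k) b) := by
    intro M' _ e b k
    rw [FirstOrder.Language.Formula.realize_relabel, Sum.elim_comp_map]
    rfl
  have hγ := hx (∼((FirstOrder.Language.Formula.iInf fun i : Fin n =>
      ψ (p i) ⊓ ∼(ψ (q i))).iExs (Fin m)))
    ⟨Set.range p ∪ Set.range q, (Set.finite_range p).union (Set.finite_range q),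
      fun e heI he => by
        rw [FirstOrder.Language.Formula.realize_not, FirstOrder.Language.Formula.realize_iExs]
        rintro ⟨b, hb⟩
        simp only [FirstOrder.Language.Formula.realize_iInf,
          FirstOrder.Language.Formula.realize_inf, FirstOrder.Language.Formula.realize_not,
          hψ] at hb
        have hinj : ∀ r : Fin n ↪ K, Set.range r ⊆ Set.range p ∪ Set.range q →
            Function.Injective fun i => (⟨fun _ => e (r i), heI _⟩ : I) := fun r hr i j hij =>
          r.injective (he (hr ⟨i, rfl⟩) (hr ⟨j, rfl⟩) (congrFun (congrArg Subtype.val hij) 0))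
        exact hn b ⟨⟨⟨_, hinj p Set.subset_union_left⟩, fun i => (hb i).1⟩,
          ⟨_, hinj q Set.subset_union_right⟩, fun i => (hb i).2⟩⟩
  rw [FirstOrder.Language.Formula.realize_not, FirstOrder.Language.Formula.realize_iExs] at hγ
  refine hγ ⟨z ∘ ε.symm, ?_⟩
  have hφ' : ∀ k, φ'.Realize (Sum.elim (fun _ => x k) (z ∘ ε.symm)) ↔
      φ.Realize (Sum.elim z fun _ => x k) := by
    intro k
    rw [FirstOrder.Language.Formula.realize_relabel]
    refine iff_of_eq (congrArg _ ?_)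
    ext (i | i) <;> simp
  simp only [FirstOrder.Language.Formula.realize_iInf,
    FirstOrder.Language.Formula.realize_inf, FirstOrder.Language.Formula.realize_not, hψ, hφ']
  exact fun i => ⟨hPR _ (hp i), hQR _ (hq i)⟩

end EM

/-! ### Assembling the exactly saturated model -/

section Main

variable {L : FirstOrder.Language.{u, v}}

theorem IsStableIndiscernibleSet.hasExactlySaturatedModel {T : L.Theory}
    (C : FirstOrder.Language.Theory.ModelType.{u, v, max u v} T) {κbar κ : Cardinal.{max u v}}
    (hκbar : ℵ₀ < κbar) (hC : IsSaturated L C κbar) {I : Set (Fin 1 → C)}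
    (hI : IsStableIndiscernibleSet L I) (h2κ : 2 ^ κ = Order.succ κ) (hκ : theoryCard L < κ) :
    HasExactlySaturatedModel T κ := by
  classical
  have h0 : ℵ₀ < κ := (le_max_right _ _).trans_lt hκ
  obtain ⟨K, hK⟩ : ∃ K : Type (max u v), #K = κ := ⟨κ.out, Cardinal.mk_out κ⟩
  have hKne : Nonempty K := by
    rw [← Cardinal.mk_ne_zero_iff, hK]
    exact (Cardinal.aleph0_pos.trans h0).ne'
  obtain ⟨_, _, hlt⟩ := HenkinVar.exists_linearOrder (L := L) (K := K)
  obtain ⟨N, x, hx, hsat⟩ := exists_henkin_model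
    (finSat_emFormulas C hI.1 (HenkinVar.base_injective (L := L) (K := K))) HenkinVar.fam
    (Set.range HenkinVar.base) (by
      rintro _ ⟨γ, -, rfl⟩ M _ y z hyz
      rw [FirstOrder.Language.Formula.realize_relabel, FirstOrder.Language.Formula.realize_relabel,
        show y ∘ HenkinVar.base = z ∘ HenkinVar.base from funext fun k => hyz _ ⟨k, rfl⟩]
      exact id) (by
      rintro ⟨k | f, g⟩ γ hγ M _ y z hyz
      · exact hγ.elim
      · obtain ⟨k, rfl⟩ := hγ
        rw [FirstOrder.Language.Formula.realize_relabel,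
          FirstOrder.Language.Formula.realize_relabel, Sum.comp_elim, Sum.comp_elim]
        have h1 : (y ∘ fun i => g ⟨k, i⟩) = z ∘ fun i => g ⟨k, i⟩ :=
          funext fun i => hyz _ (hlt f g ⟨k, i⟩).le
        have h2 : (y ∘ fun _ : Fin 1 => WType.mk (Sum.inr f) g) =
            z ∘ fun _ => WType.mk (Sum.inr f) g := funext fun _ => hyz _ le_rfl
        rw [h1, h2]
        exact id)
  have hem : ∀ γ ∈ emFormulas L I K, γ.Realize (x ∘ HenkinVar.base) := fun γ hγ => by
    have := hx _ ⟨γ, hγ, rfl⟩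
    rwa [FirstOrder.Language.Formula.realize_relabel] at this
  refine hasExactlySaturatedModel_of_splitBound (N := N) (J := Set.range (x ∘ HenkinVar.base))
    (U := Set.range x) hκ h2κ ?_ (Set.range_comp_subset_range _ _) ?_
    (splitBound_of_realize_emFormulas (fun m φ => hI.exists_bound hκbar hC φ) hem)
    (goodSet_of_realize_emFormulas hI.2.1 hem) fun q hqκ hq hqne => ?_
  · rw [Cardinal.mk_range_eq _ (injective_of_realize_emFormulas hem), hK]
  · exact Cardinal.mk_range_le.trans (HenkinVar.mk_le hκ.le h2κ hK)
  rcases q.eq_empty_or_nonempty with rfl | hqn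
  · exact ⟨x (HenkinVar.base hKne.some), ⟨_, rfl⟩, by simp⟩
  -- Repetitions let `K` index every nonempty family of size at most κ, as the labels of `HenkinVar`
  -- require.
  obtain ⟨F, hF⟩ : ∃ F : K → q, Function.Surjective F := by
    have := hqn.to_subtype
    obtain ⟨⟨g, hg⟩⟩ := (Cardinal.le_def _ _).1 (hqκ.trans hK.ge)
    exact ⟨_, Function.invFun_surjective hg⟩
  have hcode : ∀ k, ∃ (f : Σ n : ℕ, L.Formula (Fin n ⊕ Fin 1)) (g : Fin f.1 → HenkinVar L K),
      ∀ c : N, c ∈ (F k : Set N) ↔ f.2.Realize (Sum.elim (fun i => x (g i)) fun _ => c) := by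
    intro k
    obtain ⟨n, d, E, hd, hE, hDE⟩ := (hq _ (F k).2).exists_fiber
    obtain ⟨φ, rfl⟩ := Set.empty_definable_iff.1 hE
    choose g hg using hd
    refine ⟨⟨n, φ⟩, g, fun c => ?_⟩
    simp only [hg]
    exact Set.ext_iff.1 hDE fun _ => c
  choose f g hfg using hcode
  -- The formulas and parameters of the family are themselves the label and children of a variable,
  -- so the family is `fam t` and its parameters lie below `t`.
  let t : HenkinVar L K := HenkinVar.new f fun i => g i.1 i.2
  have ht : t ∉ Set.range (HenkinVar.base : K → HenkinVar L K) := by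
    rintro ⟨k, hk⟩
    simpa using (WType.mk.inj hk).1
  have hfam := hsat t ht (by
    intro s hs hsf
    rw [show HenkinVar.fam t = Set.range fun k => (f k).2.relabel
      (Sum.elim (fun i => g k i) fun _ => t) from rfl, ← Set.image_univ] at hs
    obtain ⟨A, -, hA, rfl⟩ := hsf.exists_subset_finite_image_eq hs
    obtain ⟨c, hc⟩ := Filter.generate_neBot_iff.1 hqne ((fun k => (F k : Set N)) '' A)
      (by rintro _ ⟨k, -, rfl⟩; exact (F k).2) (hA.image _)
    refine ⟨c, ?_⟩
    rintro _ ⟨k, hk, rfl⟩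
    have h1 := (hfg k c).1 (hc _ ⟨k, hk, rfl⟩)
    have h2 : ∀ i, g k i ≠ t := fun i => (hlt f (fun i => g i.1 i.2) ⟨k, i⟩).ne
    rw [FirstOrder.Language.Formula.realize_relabel, Sum.comp_elim]
    convert h1 using 2
    · exact funext fun i => Function.update_of_ne (h2 i) _ _
    · exact funext fun _ => Function.update_self _ _ _)
  refine ⟨x t, ⟨t, rfl⟩, fun D hD => ?_⟩
  obtain ⟨k, hk⟩ := hF ⟨D, hD⟩
  have hD' : D = (F k : Set N) := by rw [hk]
  rw [hD', hfg]
  have := hfam _ ⟨k, rfl⟩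
  rwa [FirstOrder.Language.Formula.realize_relabel, Sum.comp_elim] at this

end Main

end ExactSat

theorem claim2 {L : FirstOrder.Language.{u, v}} (T : L.Theory) (hT : T.IsComplete)
    -- the monster model `C` of `T`: a `κbar`-saturated model of `T` for some `κbar > |T|`
    (C : FirstOrder.Language.Theory.ModelType.{u, v, max u v} T) (κbar : Cardinal.{max u v})
    (hκbar : ExactSat.theoryCard L < κbar) (hC : ExactSat.IsSaturated L C κbar) :
    (ExactSat.IsDependent T →
      ∀ (ι : Type w) (I : Set (ι → C)),
        ExactSat.IsStableIndiscernibleSet L I ↔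
          I.Infinite ∧ ExactSat.IsIndiscernibleSet L I) ∧
    (ExactSat.IsDependent T →
      (∃ I : Set (Fin 1 → C), I.Infinite ∧ ExactSat.IsIndiscernibleSet L I) →
      ∀ κ : Cardinal.{max u v}, 2 ^ κ = Order.succ κ → ExactSat.theoryCard L < κ →
        ExactSat.HasExactlySaturatedModel T κ) ∧
    ((∃ I : Set (Fin 1 → C), ExactSat.IsStableIndiscernibleSet L I) →
      ∀ κ : Cardinal.{max u v}, 2 ^ κ = Order.succ κ → ExactSat.theoryCard L < κ →
        ExactSat.HasExactlySaturatedModel T κ) := by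
  have hκ₀ : ℵ₀ < κbar := (le_max_right _ _).trans_lt hκbar
  refine ⟨fun hdep ι I => ⟨fun h => ⟨h.1, h.2.1⟩, fun h => hdep.isStableIndiscernibleSet C h.1 h.2⟩,
    ?_, ?_⟩
  · rintro hdep ⟨I, hinf, hI⟩ κ h2κ hκ
    exact (hdep.isStableIndiscernibleSet C hinf hI).hasExactlySaturatedModel C hκ₀ hC h2κ hκ
  · rintro ⟨I, hI⟩ κ h2κ hκ
    exact hI.hasExactlySaturatedModel C hκ₀ hC h2κ hκ
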